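/- **Theorem 3.2 (Anisotropic conformable Hardy type inequality).** Let $0<\alpha\le 1$ and $p_k>1$, $L_k\in\mathbb R$ for $k=1,\dots,n$. For a function $f$ of $x=(x_1,\dots,x_n)$ the conformable partial derivative is $$D^\alpha_{x_k}f(x)=\lim_{\delta\to0}\frac{f(x_1,\dots,x_k+\delta x_k^{1-\alpha},\dots,x_n)-f(x)}{\delta},$$ and $d_\alpha x=\prod_{j}x_j^{\alpha-1}\,dx$. Let $\Omega\subset\mathbb R^n$ be a compatible domain, that is, a bounded open set, contained in $(0,\infty)^n$ if $\alpha<1$, with piecewise smooth boundary lying locally on one side of it: outside a subset of $\partial\Omega$ of zero surface measure, $\Omega$ is near each boundary point of the form $\{\rho<0\}$ with $\rho$ of class $C^1$ and $\nabla\rho\ne0$ there. Let $\nu$ be the outward unit normal, $dA$ the surface measure, and assume that the conformable surface elements $\nu_k\,d_\alpha A_k:=\nu_k\prod_{j\ne k}x_j^{\alpha-1}\,dA$ have finite total variation on $\partial\Omega$ (this follows from finiteness of the surface area if $\alpha=1$ or $\overline\Omega\subset(0,\infty)^n$). Let $W_k,H_k\ge0$ be measurable weights on $\Omega$, and let $v\in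 C(\overline\Omega)$ have continuous derivatives $D^\alpha_{x_k}v$ in $\Omega$ for all $k$, with $v>0$ in $\Omega$. Suppose that the fluxes $G_k:=W_k|D^\alpha_{x_k}v|^{p_k-2}D^\alpha_{x_k}v$ are $\alpha$-differentiable in the variable $x_k$ at every point of $\Omega$ and that $$-D^\alpha_{x_k}G_k\ \ge\ L_kH_k\,v^{p_k-1}\quad\text{in }\Omega,\qquad k=1,\dots,n.$$ Let $u\in C(\overline\Omega)$, $u\ge0$, have continuous derivatives $D^\alpha_{x_k}u$ in $\Omega$ for all $k$. 1. If $v>0$ on $\partial\Omega$ too and every $G_k$ extends continuously to $\overline\Omega$ (so that the boundary integrand is defined), then the boundary integrals below converge absolutely and $$\sum_{k=1}^n\int_\Omega W_k|D^\alpha_{x_k}u|^{p_k}\,d_\alpha x\ \ge\ \sum_{k=1}^nL_k\int_\Omega H_k|u|^{p_k}\,d_\alpha x+\sum_{k=1}^n\int_{\partial\Omega}\frac{u^{p_k}}{v^{p_k-1}}\,W_k|D^\alpha_{x_k}v|^{p_k-2}D^\alpha_{x_k}v\;\nu_k\,d_\alpha A_k ,$$ where on $\partial\Omega$ the flux $G_k$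 means its continuous extension. 2. If $u=0$ on $\partial\Omega$, then $$\sum_{k=1}^n\int_\Omega W_k|D^\alpha_{x_k}u|^{p_k}\,d_\alpha x\ \ge\ \sum_{k=1}^nL_k\int_\Omega H_k|u|^{p_k}\,d_\alpha x .$$ The integrals over $\Omega$ take values in $[0,\infty]$ and the right-hand sides are read in $[-\infty,\infty]$, with $0\cdot\infty=0$ and $(+\infty)+(-\infty)=-\infty$. -/

import Mathlib

open MeasureTheory Filter Topology Set
open scoped ENNReal

noncomputable section

/-- `f` is `α`-differentiable at `x` in the `k`-th variable: the limit as `δ → 0` of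
`(f (x₁, …, x_k + δ x_k ^ (1 - α), …, x_n) - f x) / δ` exists. -/
def ConformableDifferentiableAt {n : ℕ} (α : ℝ) (k : Fin n)
    (f : EuclideanSpace ℝ (Fin n) → ℝ) (x : EuclideanSpace ℝ (Fin n)) : Prop :=
  DifferentiableAt ℝ
    (fun δ : ℝ => f (x + EuclideanSpace.single k (δ * x k ^ (1 - α)))) 0

/-- The conformable partial derivative of order `α` in the `k`-th variable: the limit as `δ → 0`
of `(f (x₁, …, x_k + δ x_k ^ (1 - α), …, x_n) - f x) / δ`. -/
def conformableDeriv {n : ℕ} (α : ℝ) (k : Fin n)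
    (f : EuclideanSpace ℝ (Fin n) → ℝ) (x : EuclideanSpace ℝ (Fin n)) : ℝ :=
  deriv (fun δ : ℝ => f (x + EuclideanSpace.single k (δ * x k ^ (1 - α)))) 0

/-- Continuous functions on `Ω` with continuous conformable partial derivatives of order `α`
in every variable. -/
structure IsConformableC1On {n : ℕ} (α : ℝ) (f : EuclideanSpace ℝ (Fin n) → ℝ)
    (Ω : Set (EuclideanSpace ℝ (Fin n))) : Prop where
  continuousOn : ContinuousOn f Ω
  differentiableAt : ∀ k : Fin n, ∀ x ∈ Ω, ConformableDifferentiableAt α k f x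
  continuousOn_deriv : ∀ k : Fin n, ContinuousOn (conformableDeriv α k f) Ω

/-- The conformable volume `d_α x = x₁ ^ (α - 1) ⋯ x_n ^ (α - 1) dx₁ ⋯ dx_n`. -/
def conformableVolume (n : ℕ) (α : ℝ) : Measure (EuclideanSpace ℝ (Fin n)) :=
  volume.withDensity fun x => ENNReal.ofReal (∏ j, x j ^ (α - 1))

/-- `ν` is the outward unit normal of `Ω` at the boundary point `x`: near `x` the set `Ω` is
`{ρ < 0}` for a continuously differentiable function `ρ` vanishing at `x` with nonzero gradient
there, and `ν` is the normalized gradient. In particular `Ω` lies on one side of its boundary. -/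
def IsOutwardNormal {n : ℕ} (Ω : Set (EuclideanSpace ℝ (Fin n)))
    (x ν : EuclideanSpace ℝ (Fin n)) : Prop :=
  ∃ ρ : EuclideanSpace ℝ (Fin n) → ℝ,
    ContDiffAt ℝ 1 ρ x ∧ ρ x = 0 ∧ gradient ρ x ≠ 0 ∧
    (∀ᶠ y in 𝓝 x, (y ∈ Ω ↔ ρ y < 0)) ∧
    ν = ‖gradient ρ x‖⁻¹ • gradient ρ x

open Classical in
/-- The outward unit normal field of `Ω` (zero where there is none). -/
def outwardNormal {n : ℕ} (Ω : Set (EuclideanSpace ℝ (Fin n)))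
    (x : EuclideanSpace ℝ (Fin n)) : EuclideanSpace ℝ (Fin n) :=
  if h : ∃ ν, IsOutwardNormal Ω x ν then h.choose else 0

/-- The density of the conformable flux in direction `k` through `∂Ω` with respect to surface
measure: `ν_k ∏_{j ≠ k} x_j ^ (α - 1)`. This is `x_k ^ (1 - α) ν_k` times the density
`∏_j x_j ^ (α - 1)`, so it is the density that belongs to `x_k ^ (1 - α) ∂_k` and
`∏_j x_j ^ (α - 1) dx` in the divergence theorem. -/
def conformableNormal {n : ℕ} (α : ℝ) (Ω : Set (EuclideanSpace ℝ (Fin n))) (k : Fin n)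
    (x : EuclideanSpace ℝ (Fin n)) : ℝ :=
  outwardNormal Ω x k * ∏ j ∈ Finset.univ.erase k, x j ^ (α - 1)

/-- Compatible domains: bounded open sets with piecewise smooth boundary, on one side of it, on
which the conformable derivatives of order `α` make sense. The Euclidean surface measure is
`μHE[n - 1]`; the boundary is a hypersurface of class `C¹` up to a set of surface measure zero
(edges, corners), and its area is finite when measured conformably. -/
structure IsCompatible {n : ℕ} (α : ℝ) (Ω : Set (EuclideanSpace ℝ (Fin n))) : Prop where
  isOpen : IsOpen Ω
  isBounded : Bornology.IsBounded Ω
  pos : α = 1 ∨ ∀ x ∈ Ω, ∀ k, 0 < x k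
  singular_null : μHE[n - 1] {x ∈ frontier Ω | ¬ ∃ ν, IsOutwardNormal Ω x ν} = 0
  finite_area : ∀ k, IntegrableOn (conformableNormal α Ω k) (frontier Ω) μHE[n - 1]

/-- The weighted anisotropic conformable flux `W |D_k v| ^ (p - 2) D_k v`. -/
def anisotropicFlux {n : ℕ} (α : ℝ) (k : Fin n) (p : ℝ)
    (W v : EuclideanSpace ℝ (Fin n) → ℝ) (x : EuclideanSpace ℝ (Fin n)) : ℝ :=
  W x * |conformableDeriv α k v x| ^ (p - 2) * conformableDeriv α k v x

end

/-! The estimate holds for each direction k separately. Put p = p_k and F = u^p / v^(p-1) · G_k.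
Picone's inequality, which is Young's inequality applied to |D u| and u |D v| / v, together with the
supersolution inequality for v, gives D^α_k F ≤ W_k |D^α_k u|^p - L_k H_k u^p pointwise in Ω
(`exists_hasDerivAt_piconeField`). It remains to integrate this over Ω and to identify the boundary
contribution.

F is known to be differentiable in x_k only, and its derivative need not be integrable, so the
integration is done along lines parallel to the k-th axis. On such a line D^α_k is x_k^(1-α) d/dx_k.
This cancels the factor x_k^(α-1) of the conformable volume, while the other factors of the density
are constant on the line. What is left is the fundamental theorem of calculus, in the form of an
inequality (`lintegral_add_sum_endpointTerm_le`).

Almost every line meets ∂Ω only at regular points with ν_k ≠ 0 (`ae_mem_transversalBoundary`): the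
singular part of ∂Ω has a null projection because projections do not increase Hausdorff measure, and
the part with ν_k = 0 has one by a Sard type estimate. Such a line crosses ∂Ω finitely often, and
each crossing contributes sign(ν_k) F. The area formula `lintegral_tsum_insertCoord` turns the sum
over crossings, integrated over all lines, into the surface integral of F ν_k. The outcome is the
one-directional divergence inequality `IsCompatible.lintegral_add_flux_le`.

If u vanishes on ∂Ω, then u is replaced by (u - ε)₊. The field is then zero in Ω near ∂Ω, whatever v
and G_k do there, and ε → 0 by monotone convergence. Since the volume integrals may be infinite,
positive and negative parts stay on opposite sides of inequalities in `ℝ≥0∞` until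
`EReal.sum_mul_add_sum_le` combines the directions. -/

noncomputable section

/-! ### Splitting off one coordinate -/

/-- The projection of `ℝ^(m+1)` onto `ℝ^m` that forgets the `k`-th coordinate. -/
def dropCoord {m : ℕ} (k : Fin (m + 1)) :
    EuclideanSpace ℝ (Fin (m + 1)) →L[ℝ] EuclideanSpace ℝ (Fin m) :=
  LinearMap.toContinuousLinearMap
    { toFun := fun x => WithLp.toLp 2 fun j => x (k.succAbove j)
      map_add' := fun _ _ => rfl
      map_smul' := fun _ _ => rfl }

/-- The point of `ℝ^(m+1)` with `k`-th coordinate `t` and other coordinates `y`. -/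
def insertCoord {m : ℕ} (k : Fin (m + 1)) (y : EuclideanSpace ℝ (Fin m)) (t : ℝ) :
    EuclideanSpace ℝ (Fin (m + 1)) :=
  WithLp.toLp 2 (k.insertNth (α := fun _ => ℝ) t y)

section Coordinates

variable {m : ℕ} (k : Fin (m + 1))

@[simp] lemma dropCoord_apply (x : EuclideanSpace ℝ (Fin (m + 1))) (j : Fin m) :
    dropCoord k x j = x (k.succAbove j) := rfl

@[simp] lemma insertCoord_same (y : EuclideanSpace ℝ (Fin m)) (t : ℝ) :
    insertCoord k y t k = t := by
  simp [insertCoord]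

@[simp] lemma insertCoord_succAbove (y : EuclideanSpace ℝ (Fin m)) (t : ℝ) (j : Fin m) :
    insertCoord k y t (k.succAbove j) = y j := by
  simp [insertCoord]

lemma euclidean_ext_succAbove {x y : EuclideanSpace ℝ (Fin (m + 1))} (h : x k = y k)
    (h' : ∀ j, x (k.succAbove j) = y (k.succAbove j)) : x = y := by
  ext i
  rcases Fin.eq_self_or_eq_succAbove k i with rfl | ⟨j, rfl⟩
  · exact h
  · exact h' j

@[simp] lemma dropCoord_insertCoord (y : EuclideanSpace ℝ (Fin m)) (t : ℝ) :
    dropCoord k (insertCoord k y t) = y := by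
  ext j; simp

@[simp] lemma insertCoord_dropCoord (x : EuclideanSpace ℝ (Fin (m + 1))) :
    insertCoord k (dropCoord k x) (x k) = x :=
  euclidean_ext_succAbove k (by simp) (by simp)

lemma insertCoord_eq_add (y : EuclideanSpace ℝ (Fin m)) (t s : ℝ) :
    insertCoord k y s = insertCoord k y t + EuclideanSpace.single k (s - t) :=
  euclidean_ext_succAbove k (by simp) (by simp)

lemma continuous_insertCoord :
    Continuous fun q : EuclideanSpace ℝ (Fin m) × ℝ => insertCoord k q.1 q.2 := by
  unfold insertCoord
  refine (PiLp.continuous_toLp 2 _).comp ?_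
  refine continuous_pi fun i => ?_
  rcases Fin.eq_self_or_eq_succAbove k i with rfl | ⟨j, rfl⟩
  · simpa using continuous_snd
  · simp only [Fin.insertNth_apply_succAbove]
    fun_prop

lemma continuous_insertCoord_right (y : EuclideanSpace ℝ (Fin m)) :
    Continuous (insertCoord k y) :=
  (continuous_insertCoord k).comp (by fun_prop : Continuous fun t : ℝ => (y, t))

lemma norm_sq_eq_dropCoord (x : EuclideanSpace ℝ (Fin (m + 1))) :
    ‖x‖ ^ 2 = ‖dropCoord k x‖ ^ 2 + x k ^ 2 := by
  rw [EuclideanSpace.real_norm_sq_eq, EuclideanSpace.real_norm_sq_eq, Fin.sum_univ_succAbove _ k]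
  simp [add_comm]

lemma inner_eq_dropCoord (x y : EuclideanSpace ℝ (Fin (m + 1))) :
    inner ℝ x y = inner ℝ (dropCoord k x) (dropCoord k y) + x k * y k := by
  simp only [PiLp.inner_apply, Fin.sum_univ_succAbove _ k]
  simp [add_comm, mul_comm]

lemma norm_dropCoord_le (x : EuclideanSpace ℝ (Fin (m + 1))) : ‖dropCoord k x‖ ≤ ‖x‖ := by
  have := norm_sq_eq_dropCoord k x
  exact le_of_sq_le_sq (by nlinarith [sq_nonneg (x k)]) (norm_nonneg _)

lemma measurePreserving_insertCoord :
    MeasurePreserving (fun q : EuclideanSpace ℝ (Fin m) × ℝ => insertCoord k q.1 q.2)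
      (volume.prod volume) volume := by
  have h1 := (volume_preserving_piFinSuccAbove (fun _ : Fin (m + 1) => ℝ) k).symm
  have h2 := (EuclideanSpace.volume_preserving_symm_measurableEquiv_toLp (Fin (m + 1))).symm
  have h3 := (EuclideanSpace.volume_preserving_symm_measurableEquiv_toLp (Fin m))
  have h4 : MeasurePreserving (fun q : EuclideanSpace ℝ (Fin m) × ℝ => (q.2, (q.1 : Fin m → ℝ)))
      (volume.prod volume) (volume.prod volume) :=
    ((MeasurePreserving.id volume).prod h3).comp Measure.measurePreserving_swap
  exact h2.comp (h1.comp h4)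

/-- Fubini's theorem for lines in direction `k`. -/
lemma lintegral_eq_lintegral_insertCoord {f : EuclideanSpace ℝ (Fin (m + 1)) → ℝ≥0∞}
    (hf : AEMeasurable f) :
    ∫⁻ x, f x = ∫⁻ y, ∫⁻ t, f (insertCoord k y t) := by
  have hemb : MeasurableEmbedding
      (fun q : EuclideanSpace ℝ (Fin m) × ℝ => insertCoord k q.1 q.2) := by
    refine (continuous_insertCoord k).measurableEmbedding fun p q h => ?_
    have h1 := congrArg (dropCoord k) h
    have h2 := congrArg (fun x : EuclideanSpace ℝ (Fin (m + 1)) => x k) h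
    simp only [dropCoord_insertCoord, insertCoord_same] at h1 h2
    exact Prod.ext h1 h2
  rw [← (measurePreserving_insertCoord k).lintegral_comp_emb hemb]
  exact lintegral_prod _ (hf.comp_quasiMeasurePreserving
      (measurePreserving_insertCoord k).quasiMeasurePreserving)

end Coordinates

/-! ### The fundamental theorem of calculus on open subsets of the line -/

section Line

open Classical in
/-- The contribution of the boundary point `z` of `O ⊆ ℝ` in the fundamental theorem of calculus:
`F z` if `O` lies to the left of `z`, minus `F z` if `O` lies to the right of `z`. -/
def endpointTerm (O : Set ℝ) (F : ℝ → ℝ) (z : ℝ) : ℝ :=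
  (if O ∈ 𝓝[<] z then F z else 0) - (if O ∈ 𝓝[>] z then F z else 0)

-- By connectedness, an interval without boundary points lies inside `O` or misses it. In the first
-- case this is the fundamental theorem of calculus for a derivative bounded by an integrable
-- function; in the second both sides vanish.
open Classical in
lemma sub_le_setIntegral_of_frontier_disjoint {O : Set ℝ} (hO : IsOpen O) {F F' g : ℝ → ℝ}
    (hF : ContinuousOn F (closure O)) (hF' : ∀ t ∈ O, HasDerivAt F (F' t) t)
    (hg : IntegrableOn g O) (hle : ∀ t ∈ O, F' t ≤ g t) {c d : ℝ} (hcd : c < d)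
    (hfr : Disjoint (frontier O) (Ioo c d)) :
    (if O ∈ 𝓝[<] d then F d else 0) - (if O ∈ 𝓝[>] c then F c else 0) ≤
      ∫ t in O ∩ Ioo c d, g t := by
  by_cases hne : (Ioo c d ∩ O).Nonempty
  · have hsub : Ioo c d ⊆ O := by
      refine isPreconnected_Ioo.subset_left_of_subset_union hO isClosed_closure.isOpen_compl
        (disjoint_compl_right.mono_left subset_closure) (fun t ht => ?_) hne
      by_contra h
      simp only [mem_union, mem_compl_iff, not_or, not_not] at h
      exact hfr.le_bot ⟨⟨h.2, by rw [hO.interior_eq]; exact h.1⟩, ht⟩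
    have hcl : Icc c d ⊆ closure O := by
      rw [← closure_Ioo hcd.ne]; exact closure_mono hsub
    rw [if_pos (mem_of_superset (Ioo_mem_nhdsLT hcd) hsub),
      if_pos (mem_of_superset (Ioo_mem_nhdsGT hcd) hsub), inter_eq_right.2 hsub,
      ← integral_Ioc_eq_integral_Ioo, ← intervalIntegral.integral_of_le hcd.le]
    refine intervalIntegral.sub_le_integral_of_hasDeriv_right_of_le hcd.le (hF.mono hcl)
      (fun t ht => (hF' t (hsub ht)).hasDerivWithinAt) ?_ fun t ht => hle t (hsub ht)
    rw [integrableOn_Icc_iff_integrableOn_Ioo]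
    exact hg.mono_set hsub
  · have hemp : O ∩ Ioo c d = ∅ := by rw [inter_comm]; exact not_nonempty_iff_eq_empty.1 hne
    have h1 : O ∉ 𝓝[<] d := fun h => by
      obtain ⟨t, ht⟩ := Filter.nonempty_of_mem (inter_mem h (Ioo_mem_nhdsLT hcd))
      exact hne ⟨t, ht.2, ht.1⟩
    have h2 : O ∉ 𝓝[>] c := fun h => by
      obtain ⟨t, ht⟩ := Filter.nonempty_of_mem (inter_mem h (Ioo_mem_nhdsGT hcd))
      exact hne ⟨t, ht.2, ht.1⟩
    simp [h1, h2, hemp]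

-- Induction on the largest point of `S`. The one-sided terms at `c` and `d` are carried along so
-- that neighbouring intervals can be glued: the left and right terms at a common endpoint `z` add
-- up to the `endpointTerm` at `z`.
open Classical in
lemma sub_add_sum_endpointTerm_le {O : Set ℝ} (hO : IsOpen O) {F F' g : ℝ → ℝ}
    (hF : ContinuousOn F (closure O)) (hF' : ∀ t ∈ O, HasDerivAt F (F' t) t)
    (hg : IntegrableOn g O) (hle : ∀ t ∈ O, F' t ≤ g t) {c : ℝ} (S : Finset ℝ) :
    ∀ d, c < d → frontier O ∩ Ioo c d ⊆ S → (S : Set ℝ) ⊆ Ioo c d →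
    (if O ∈ 𝓝[<] d then F d else 0) - (if O ∈ 𝓝[>] c then F c else 0) +
      ∑ z ∈ S, endpointTerm O F z ≤ ∫ t in O ∩ Ioo c d, g t := by
  induction S using Finset.induction_on_max with
  | empty =>
    intro d hcd hfr _
    simpa using sub_le_setIntegral_of_frontier_disjoint hO hF hF' hg hle hcd
      (disjoint_iff_inter_eq_empty.2 (subset_empty_iff.1 (by simpa using hfr)))
  | insert z S hmax ih =>
    intro d hcd hfr hS
    have hz : z ∈ Ioo c d := hS (by simp)
    have h1 := ih z hz.1 (fun t ht => by
      have := hfr ⟨ht.1, ht.2.1, ht.2.2.trans hz.2⟩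
      simp only [Finset.coe_insert, mem_insert_iff] at this
      exact this.resolve_left ht.2.2.ne) (fun t ht => ⟨(hS (by simp [Finset.mem_coe.1 ht])).1, hmax t ht⟩)
    have h2 := sub_le_setIntegral_of_frontier_disjoint hO hF hF' hg hle hz.2 (by
      refine Set.disjoint_left.2 fun t ht ht' => ?_
      have := hfr ⟨ht, hz.1.trans ht'.1, ht'.2⟩
      simp only [Finset.coe_insert, mem_insert_iff] at this
      rcases this with rfl | h
      · exact lt_irrefl _ ht'.1
      · exact (hmax t h).not_gt ht'.1)
    rw [Finset.sum_insert fun h => lt_irrefl _ (hmax z h), endpointTerm]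
    have h3 : ∫ t in O ∩ Ioo c d, g t = (∫ t in O ∩ Ioo c z, g t) + ∫ t in O ∩ Ioo z d, g t := by
      rw [← setIntegral_union (Set.disjoint_left.2 fun t ht ht' => ht.2.2.not_gt ht'.2.1)
        (hO.measurableSet.inter measurableSet_Ioo) (hg.mono_set inter_subset_left)
        (hg.mono_set inter_subset_left)]
      refine setIntegral_congr_set ?_
      have : (volume : Measure ℝ) {z} = 0 := by simp
      filter_upwards [compl_mem_ae_iff.2 this] with t ht
      have ht : t ≠ z := ht
      refine propext ⟨fun h => ?_, fun h => ?_⟩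
      · rcases lt_or_gt_of_ne ht with h' | h'
        · exact Or.inl ⟨h.1, h.2.1, h'⟩
        · exact Or.inr ⟨h.1, h', h.2.2⟩
      · rcases h with h | h
        · exact ⟨h.1, h.2.1, h.2.2.trans hz.2⟩
        · exact ⟨h.1, hz.1.trans h.2.1, h.2.2⟩
    rw [h3]
    linarith

/-- A divergence theorem (as an inequality) for bounded open subsets of the line with finitely many
boundary points. -/
theorem sum_endpointTerm_le_setIntegral {O : Set ℝ} (hO : IsOpen O) (hb : Bornology.IsBounded O)
    {F F' g : ℝ → ℝ} (hF : ContinuousOn F (closure O)) (hF' : ∀ t ∈ O, HasDerivAt F (F' t) t)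
    (hg : IntegrableOn g O) (hle : ∀ t ∈ O, F' t ≤ g t) (S : Finset ℝ)
    (hS : frontier O ⊆ S) : ∑ z ∈ S, endpointTerm O F z ≤ ∫ t in O, g t := by
  obtain ⟨r, hr⟩ := (hb.union S.finite_toSet.isBounded).subset_ball 0
  have hr' : ∀ t ∈ O ∪ S, -(|r| + 1) < t ∧ t < |r| + 1 := fun t ht => by
    have h := hr ht
    rw [Metric.mem_ball, Real.dist_eq, sub_zero, abs_lt] at h
    constructor <;> linarith [le_abs_self r]
  have hneg : -(|r| + 1) < |r| + 1 := by linarith [abs_nonneg r]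
  have h := sub_add_sum_endpointTerm_le hO hF hF' hg hle S (|r| + 1) hneg
    (inter_subset_left.trans hS) fun t ht => hr' t (Or.inr ht)
  -- `O` lies in the ball of radius `r`, so it stays away from the two outer endpoints and their
  -- terms drop out.
  have h1 : O ∉ 𝓝[<] (|r| + 1) := fun h => by
    obtain ⟨t, ht, ht'⟩ := Filter.nonempty_of_mem
      (inter_mem h (Ioo_mem_nhdsLT (by linarith : |r| < |r| + 1)))
    have h3 := hr (Or.inl ht)
    rw [Metric.mem_ball, Real.dist_eq, sub_zero, abs_lt] at h3
    linarith [ht'.1, le_abs_self r]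
  have h2 : O ∉ 𝓝[>] (-(|r| + 1)) := fun h => by
    obtain ⟨t, ht, ht'⟩ := Filter.nonempty_of_mem
      (inter_mem h (Ioo_mem_nhdsGT (by linarith : -(|r| + 1) < -|r|)))
    have h3 := hr (Or.inl ht)
    rw [Metric.mem_ball, Real.dist_eq, sub_zero, abs_lt] at h3
    linarith [ht'.2, le_abs_self r]
  have hsub : O ⊆ Ioo (-(|r| + 1)) (|r| + 1) := fun t ht => hr' t (Or.inl ht)
  rw [if_neg h1, if_neg h2, inter_eq_left.2 hsub] at h
  simpa using h

/-- The divergence theorem on the line when the derivative is only bounded above by a difference of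
nonnegative functions, none of which is known to be integrable. -/
theorem lintegral_add_sum_endpointTerm_le {O : Set ℝ} (hO : IsOpen O)
    (hb : Bornology.IsBounded O) {F F' g h : ℝ → ℝ} (hF : ContinuousOn F (closure O))
    (hF' : ∀ t ∈ O, HasDerivAt F (F' t) t) (hgm : AEMeasurable g (volume.restrict O))
    (hhm : AEMeasurable h (volume.restrict O)) (hg : ∀ t ∈ O, 0 ≤ g t) (hh : ∀ t ∈ O, 0 ≤ h t)
    (hle : ∀ t ∈ O, F' t ≤ g t - h t) (S : Finset ℝ) (hS : frontier O ⊆ S) :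
    (∫⁻ t in O, ENNReal.ofReal (h t)) + ∑ z ∈ S, ENNReal.ofReal (endpointTerm O F z) ≤
      (∫⁻ t in O, ENNReal.ofReal (g t)) + ∑ z ∈ S, ENNReal.ofReal (-endpointTerm O F z) := by
  by_cases htop : ∫⁻ t in O, ENNReal.ofReal (g t) = ⊤
  · simp [htop]
  have hgO : ∀ᵐ t ∂volume.restrict O, 0 ≤ g t :=
    (ae_restrict_iff' hO.measurableSet).2 (ae_of_all _ hg)
  have hhO : ∀ᵐ t ∂volume.restrict O, 0 ≤ h t :=
    (ae_restrict_iff' hO.measurableSet).2 (ae_of_all _ hh)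
  have hgi : IntegrableOn g O :=
    (lintegral_ofReal_ne_top_iff_integrable hgm.aestronglyMeasurable hgO).1 htop
  have hfin : volume O ≠ ⊤ := hb.measure_lt_top.ne
  -- Cutting `h` off at `N` makes it integrable, as `O` has finite length, and only weakens the
  -- bound on `F'`. Monotone convergence in `N` removes the cut-off.
  have key : ∀ N : ℕ, (∫⁻ t in O, ENNReal.ofReal (min (h t) N)) +
      ∑ z ∈ S, ENNReal.ofReal (endpointTerm O F z) ≤
      (∫⁻ t in O, ENNReal.ofReal (g t)) + ∑ z ∈ S, ENNReal.ofReal (-endpointTerm O F z) := by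
    intro N
    have hNm : ∀ᵐ t ∂volume.restrict O, 0 ≤ min (h t) N := by
      filter_upwards [hhO] with t ht using le_min ht (Nat.cast_nonneg _)
    have hNi : IntegrableOn (fun t => min (h t) N) O := by
      have : IsFiniteMeasure (volume.restrict O) := ⟨by simpa using hfin.lt_top⟩
      refine Integrable.of_bound (hhm.min aemeasurable_const).aestronglyMeasurable (N : ℝ) ?_
      filter_upwards [hNm] with t ht
      rw [Real.norm_of_nonneg ht]; exact min_le_right _ _
    have h1 := sum_endpointTerm_le_setIntegral hO hb hF hF' (hgi.sub hNi)
      (fun t ht => (hle t ht).trans (sub_le_sub_left (min_le_left _ _) _)) S hS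
    simp only [Pi.sub_apply] at h1
    rw [integral_sub hgi hNi] at h1
    rw [← ofReal_integral_eq_lintegral_ofReal hgi hgO,
      ← ofReal_integral_eq_lintegral_ofReal hNi hNm]
    have hS1 : ∀ f : ℝ → ℝ, ∑ z ∈ S, ENNReal.ofReal (f z) =
        ENNReal.ofReal (∑ z ∈ S, max (f z) 0) := fun f => by
      rw [ENNReal.ofReal_sum_of_nonneg fun _ _ => le_max_right _ _]
      refine Finset.sum_congr rfl fun z _ => ?_
      rcases le_total (f z) 0 with h | h
      · rw [max_eq_right h, ENNReal.ofReal_of_nonpos h, ENNReal.ofReal_zero]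
      · rw [max_eq_left h]
    rw [hS1, hS1 fun z => -endpointTerm O F z,
      ← ENNReal.ofReal_add (integral_nonneg_of_ae hNm) (Finset.sum_nonneg fun _ _ => le_max_right _ _),
      ← ENNReal.ofReal_add (integral_nonneg_of_ae hgO) (Finset.sum_nonneg fun _ _ => le_max_right _ _)]
    refine ENNReal.ofReal_le_ofReal ?_
    have h2 : ∑ z ∈ S, max (endpointTerm O F z) 0 =
        ∑ z ∈ S, endpointTerm O F z + ∑ z ∈ S, max (-endpointTerm O F z) 0 := by
      rw [← Finset.sum_add_distrib]
      refine Finset.sum_congr rfl fun z _ => ?_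
      rcases le_total (endpointTerm O F z) 0 with h | h
      · rw [max_eq_right h, max_eq_left (by linarith)]; ring
      · rw [max_eq_left h, max_eq_right (by linarith)]; ring
    linarith
  have hlim : Tendsto (fun N : ℕ => ∫⁻ t in O, ENNReal.ofReal (min (h t) N)) atTop
      (𝓝 (∫⁻ t in O, ENNReal.ofReal (h t))) := by
    refine lintegral_tendsto_of_tendsto_of_monotone
      (fun N => (hhm.min aemeasurable_const).ennreal_ofReal) ?_ ?_
    · refine ae_of_all _ fun t N M hNM => ENNReal.ofReal_le_ofReal ?_
      exact min_le_min_left _ (Nat.cast_le.2 hNM)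
    · refine ae_of_all _ fun t => tendsto_const_nhds.congr' ?_
      obtain ⟨N, hN⟩ := exists_nat_ge (h t)
      filter_upwards [eventually_ge_atTop N] with M hM
      rw [min_eq_left (hN.trans (Nat.cast_le.2 hM))]
  exact le_of_tendsto' (hlim.add_const _) key

end Line

/-! ### Picone's inequality along a line -/

section Picone

lemma hasDerivAt_max_zero_rpow {p : ℝ} (hp : 1 < p) (r : ℝ) :
    HasDerivAt (fun r : ℝ => max r 0 ^ p) (p * max r 0 ^ (p - 1)) r := by
  rcases lt_trichotomy r 0 with hr | rfl | hr
  · have h : (fun r : ℝ => max r 0 ^ p) =ᶠ[𝓝 r] fun _ => 0 := by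
      filter_upwards [Iio_mem_nhds hr] with s hs
      rw [max_eq_right (le_of_lt hs), Real.zero_rpow (by linarith)]
    rw [max_eq_right hr.le, Real.zero_rpow (by linarith), mul_zero]
    exact (hasDerivAt_const r 0).congr_of_eventuallyEq h
  -- At the kink the function is dominated by |s|^p, which is o(s) because p > 1.
  · have h := hasDerivAt_abs_rpow 0 hp
    rw [hasDerivAt_iff_isLittleO] at h ⊢
    simp only [abs_zero, mul_zero, smul_zero, sub_zero, max_self,
      Real.zero_rpow (by linarith : p ≠ 0), Real.zero_rpow (by linarith : p - 1 ≠ 0)] at h ⊢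
    refine (Asymptotics.IsBigO.of_norm_le fun s => ?_).trans_isLittleO h
    rw [Real.norm_of_nonneg (Real.rpow_nonneg (le_max_right _ _) _)]
    exact Real.rpow_le_rpow (le_max_right _ _) (max_le (le_abs_self s) (abs_nonneg s)) (by linarith)
  · have h : (fun r : ℝ => max r 0 ^ p) =ᶠ[𝓝 r] fun s => s ^ p := by
      filter_upwards [Ioi_mem_nhds hr] with s hs
      rw [max_eq_left (le_of_lt hs)]
    rw [max_eq_left hr.le]
    exact (Real.hasDerivAt_rpow_const (Or.inl hr.ne')).congr_of_eventuallyEq h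

lemma young_rpow {p a b : ℝ} (hp : 1 < p) (ha : 0 ≤ a) (hb : 0 ≤ b) :
    p * (a * b ^ (p - 1)) ≤ a ^ p + (p - 1) * b ^ p := by
  have hpq := Real.HolderConjugate.conjExponent hp
  have h := Real.young_inequality_of_nonneg ha (Real.rpow_nonneg hb (p - 1)) hpq
  have hq : (p - 1) * p.conjExponent = p := by
    rw [Real.conjExponent]; field_simp [(by linarith : p - 1 ≠ 0)]
  rw [← Real.rpow_mul hb, hq] at h
  have h2 : p * (b ^ p / p.conjExponent) = (p - 1) * b ^ p := by
    have : p - 1 ≠ 0 := by linarith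
    rw [Real.conjExponent]; field_simp
  have h3 := mul_le_mul_of_nonneg_left h (by linarith : (0 : ℝ) ≤ p)
  rwa [mul_add, h2, mul_div_cancel₀ _ (by linarith : p ≠ 0)] at h3

/-- The pointwise Picone inequality. -/
lemma picone_inequality {p a b w c d : ℝ} (hp : 1 < p) (ha : 0 ≤ a) (hb : 0 < b) (hw : 0 ≤ w) :
    (p * a ^ (p - 1) * c * b ^ (1 - p) + a ^ p * ((1 - p) * b ^ (-p) * d)) *
      (w * |d| ^ (p - 2) * d) ≤ w * |c| ^ p := by
  have hd1 : |d| ^ (p - 2) * d * d = |d| ^ p := by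
    rcases eq_or_ne d 0 with rfl | hd
    · simp [Real.zero_rpow (by linarith : p ≠ 0)]
    · have : (0 : ℝ) < |d| := abs_pos.2 hd
      rw [mul_assoc, ← abs_mul_abs_self d, ← pow_two, ← Real.rpow_natCast |d| 2,
        ← Real.rpow_add this]
      norm_num
  have hd2 : |(|d| ^ (p - 2) * d)| = |d| ^ (p - 1) := by
    rcases eq_or_ne d 0 with rfl | hd
    · simp [Real.zero_rpow (by linarith : p - 1 ≠ 0)]
    · have : (0 : ℝ) < |d| := abs_pos.2 hd
      rw [abs_mul, abs_of_nonneg (Real.rpow_nonneg (abs_nonneg d) _)]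
      nth_rw 2 [← Real.rpow_one |d|]
      rw [← Real.rpow_add this]
      ring_nf
  have hc : c * (|d| ^ (p - 2) * d) ≤ |c| * |d| ^ (p - 1) := by
    rw [← hd2, ← abs_mul]; exact le_abs_self _
  -- Young's inequality for |c| and a|d|/b: the powers of b then match those in the derivative of
  -- a^p b^(1-p).
  have hy := young_rpow hp (abs_nonneg c) (div_nonneg (mul_nonneg ha (abs_nonneg d)) hb.le)
  rw [Real.div_rpow (mul_nonneg ha (abs_nonneg d)) hb.le,
    Real.div_rpow (mul_nonneg ha (abs_nonneg d)) hb.le, Real.mul_rpow ha (abs_nonneg d),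
    Real.mul_rpow ha (abs_nonneg d)] at hy
  have hb1 : b ^ (1 - p) = (b ^ (p - 1))⁻¹ := by
    rw [← Real.rpow_neg hb.le, neg_sub]
  rw [hb1, Real.rpow_neg hb.le]
  have e1 : (0 : ℝ) ≤ p * a ^ (p - 1) * (b ^ (p - 1))⁻¹ := by positivity
  have h1 := mul_le_mul_of_nonneg_left hc e1
  calc _ = w * (p * a ^ (p - 1) * (b ^ (p - 1))⁻¹ * (c * (|d| ^ (p - 2) * d)) -
        (p - 1) * (a ^ p * (|d| ^ (p - 2) * d * d) / b ^ p)) := by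
        rw [div_eq_mul_inv]; ring
    _ ≤ w * |c| ^ p := by
        refine mul_le_mul_of_nonneg_left ?_ hw
        rw [hd1]
        have h2 : p * a ^ (p - 1) * (b ^ (p - 1))⁻¹ * (|c| * |d| ^ (p - 1)) =
            p * (|c| * (a ^ (p - 1) * |d| ^ (p - 1) / b ^ (p - 1))) := by
          rw [div_eq_mul_inv]; ring
        linarith

variable {m : ℕ} {k : Fin (m + 1)}

/-- The field `(u - ε)₊ ^ p / v ^ (p - 1) * G` in Picone's inequality. -/
def piconeField {n : ℕ} (p ε : ℝ) (u v G : EuclideanSpace ℝ (Fin n) → ℝ)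
    (x : EuclideanSpace ℝ (Fin n)) : ℝ :=
  max (u x - ε) 0 ^ p / v x ^ (p - 1) * G x

/-- The chain rule for δ = (s - t) t^(α-1), which turns the conformable increment δ t^(1-α) into s -
t. This needs t^(α-1) t^(1-α) = 1, hence t > 0 unless α = 1. -/
lemma ConformableDifferentiableAt.hasDerivAt_line {α : ℝ} {f : EuclideanSpace ℝ (Fin (m + 1)) → ℝ}
    {y : EuclideanSpace ℝ (Fin m)} {t : ℝ}
    (h : ConformableDifferentiableAt α k f (insertCoord k y t)) (ht : α = 1 ∨ 0 < t) :
    HasDerivAt (fun s => f (insertCoord k y s))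
      (t ^ (α - 1) * conformableDeriv α k f (insertCoord k y t)) t := by
  have hc : t ^ (α - 1) * t ^ (1 - α) = 1 := by
    rcases ht with rfl | ht
    · simp
    · rw [← Real.rpow_add ht]; simp
  have h1 : HasDerivAt (fun s : ℝ => (s - t) * t ^ (α - 1)) (t ^ (α - 1)) t := by
    simpa using ((hasDerivAt_id t).sub_const t).mul_const (t ^ (α - 1))
  have h2 := h.hasDerivAt
  rw [show (0 : ℝ) = (t - t) * t ^ (α - 1) by simp] at h2
  have h3 := h2.comp t h1
  rw [mul_comm]
  refine (h3.congr_of_eventuallyEq (Eventually.of_forall fun s => ?_)).congr_deriv ?_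
  · simp only [Function.comp_apply, insertCoord_same]
    rw [mul_assoc, hc, mul_one, ← insertCoord_eq_add]
  · simp [conformableDeriv]

/-- Along a line in direction `k` the derivative of the Picone field is controlled by the energy
density of `u`, if `v` is a supersolution. -/
lemma exists_hasDerivAt_piconeField {α p ε l : ℝ} (hp : 1 < p)
    {W H u v : EuclideanSpace ℝ (Fin (m + 1)) → ℝ} {y : EuclideanSpace ℝ (Fin m)} {t : ℝ}
    (ht : α = 1 ∨ 0 < t) (hW : 0 ≤ W (insertCoord k y t)) (hv : 0 < v (insertCoord k y t))
    (hvd : ConformableDifferentiableAt α k v (insertCoord k y t))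
    (hud : ConformableDifferentiableAt α k u (insertCoord k y t))
    (hG : ConformableDifferentiableAt α k (anisotropicFlux α k p W v) (insertCoord k y t))
    (hineq : l * H (insertCoord k y t) * v (insertCoord k y t) ^ (p - 1) ≤
      -conformableDeriv α k (anisotropicFlux α k p W v) (insertCoord k y t)) :
    ∃ D, HasDerivAt (fun s => piconeField p ε u v (anisotropicFlux α k p W v)
        (insertCoord k y s)) D t ∧
      D ≤ t ^ (α - 1) * (W (insertCoord k y t) *
          |conformableDeriv α k u (insertCoord k y t)| ^ p) -
        t ^ (α - 1) * (l * (H (insertCoord k y t) * max (u (insertCoord k y t) - ε) 0 ^ p)) := by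
  have hc : 0 ≤ t ^ (α - 1) := by
    rcases ht with rfl | ht
    · simp
    · positivity
  set x := insertCoord k y t with hx
  have hu1 := (hud.hasDerivAt_line ht).sub_const ε
  have hA := (hasDerivAt_max_zero_rpow hp (u x - ε)).comp t hu1
  have hB := (Real.hasDerivAt_rpow_const (p := 1 - p) (Or.inl hv.ne')).comp t
    (hvd.hasDerivAt_line ht)
  have hF := (hA.mul hB).mul (hG.hasDerivAt_line ht)
  rw [← hx] at hF
  -- The product rule is applied to v^(1-p), which agrees with 1 / v^(p-1) where v > 0, hence near
  -- `t` by continuity along the line.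
  have hpow : ∀ s, (fun s => v (insertCoord k y s)) s ∈ Ioi 0 →
      v (insertCoord k y s) ^ (1 - p) = (v (insertCoord k y s) ^ (p - 1))⁻¹ := fun s hs => by
    rw [← Real.rpow_neg (le_of_lt hs), neg_sub]
  refine ⟨_, hF.congr_of_eventuallyEq ?_, ?_⟩
  · filter_upwards [(hvd.hasDerivAt_line ht).continuousAt.preimage_mem_nhds (Ioi_mem_nhds hv)]
      with s hs
    simp only [piconeField, Pi.mul_apply, Function.comp_apply]
    rw [hpow s hs, div_eq_mul_inv]
  · simp only [Pi.mul_apply, Function.comp_apply, ← hx]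
    set a := max (u x - ε) 0 with ha
    have ha0 : 0 ≤ a := le_max_right _ _
    have hpic := picone_inequality (c := conformableDeriv α k u x) (d := conformableDeriv α k v x)
      hp ha0 hv hW
    have h1 : a ^ p * v x ^ (1 - p) * conformableDeriv α k (anisotropicFlux α k p W v) x ≤
        -(l * (H x * a ^ p)) := by
      have h2 := mul_le_mul_of_nonneg_left hineq
        (by positivity : 0 ≤ a ^ p * v x ^ (1 - p))
      have h3 : v x ^ (1 - p) * v x ^ (p - 1) = 1 := by
        rw [← Real.rpow_add hv]; simp
      have h4 : a ^ p * v x ^ (1 - p) * (l * H x * v x ^ (p - 1)) = l * (H x * a ^ p) := by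
        calc _ = a ^ p * l * H x * (v x ^ (1 - p) * v x ^ (p - 1)) := by ring
          _ = _ := by rw [h3]; ring
      linarith
    have h5 := mul_le_mul_of_nonneg_left (add_le_add hpic h1) hc
    have h6 : (1 : ℝ) - p - 1 = -p := by ring
    rw [h6]
    refine le_trans (le_of_eq ?_) (h5.trans (le_of_eq (by ring)))
    simp only [anisotropicFlux]
    ring

end Picone

/-! ### The outward normal and the regular boundary -/

section Normal

variable {n : ℕ} {Ω : Set (EuclideanSpace ℝ (Fin n))} {x ν : EuclideanSpace ℝ (Fin n)}

/-- The boundary points of `Ω` at which the outward normal exists. -/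
def regularBoundary (Ω : Set (EuclideanSpace ℝ (Fin n))) : Set (EuclideanSpace ℝ (Fin n)) :=
  {x ∈ frontier Ω | ∃ ν, IsOutwardNormal Ω x ν}

lemma isOutwardNormal_outwardNormal (h : ∃ ν, IsOutwardNormal Ω x ν) :
    IsOutwardNormal Ω x (outwardNormal Ω x) := by
  rw [outwardNormal, dif_pos h]; exact h.choose_spec

lemma IsOutwardNormal.norm_eq_one (h : IsOutwardNormal Ω x ν) : ‖ν‖ = 1 := by
  obtain ⟨ρ, -, -, h0, -, rfl⟩ := h
  exact norm_smul_inv_norm' h0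
where
  norm_smul_inv_norm' {g : EuclideanSpace ℝ (Fin n)} (h0 : g ≠ 0) : ‖‖g‖⁻¹ • g‖ = 1 := by
    rw [norm_smul, norm_inv, norm_norm, inv_mul_cancel₀ (norm_ne_zero_iff.2 h0)]

lemma hasStrictFDerivAt_gradient {ρ : EuclideanSpace ℝ (Fin n) → ℝ} (h : ContDiffAt ℝ 1 ρ x) :
    HasStrictFDerivAt ρ (innerSL ℝ (gradient ρ x)) x := by
  have h1 := h.hasStrictFDerivAt one_ne_zero
  have h2 := (h.differentiableAt one_ne_zero).hasGradientAt.hasFDerivAt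
  exact h2.fderiv ▸ h1

lemma continuousAt_gradient {ρ : EuclideanSpace ℝ (Fin n) → ℝ} (h : ContDiffAt ℝ 1 ρ x) :
    ContinuousAt (gradient ρ) x := by
  have h1 : ContinuousAt (fderiv ℝ ρ) x :=
    (h.fderiv_right (m := 0) (by norm_num)).continuousAt
  exact (InnerProductSpace.toDual ℝ _).symm.continuous.continuousAt.comp h1

/-- The derivative of a function along the ray in direction `e`. -/
lemma hasDerivAt_ray {ρ : EuclideanSpace ℝ (Fin n) → ℝ} (h : ContDiffAt ℝ 1 ρ x)
    (e : EuclideanSpace ℝ (Fin n)) :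
    HasDerivAt (fun s : ℝ => ρ (x + s • e)) (inner ℝ (gradient ρ x) e) 0 := by
  have h1 : HasDerivAt (fun s : ℝ => x + s • e) e 0 := by
    simpa using ((hasDerivAt_id (0 : ℝ)).smul_const e).const_add x
  have h2 : HasFDerivAt ρ (innerSL ℝ (gradient ρ x)) (x + (0 : ℝ) • e) := by
    rw [zero_smul, add_zero]; exact (hasStrictFDerivAt_gradient h).hasFDerivAt
  exact h2.comp_hasDerivAt 0 h1

lemma eventually_pos_of_hasDerivAt {g : ℝ → ℝ} {g' t : ℝ} (h : HasDerivAt g g' t) (h0 : g t = 0)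
    (hpos : 0 < g') : (∀ᶠ s in 𝓝[<] t, g s < 0) ∧ ∀ᶠ s in 𝓝[>] t, 0 < g s := by
  have h1 := (hasDerivAt_iff_tendsto_slope.1 h).eventually (lt_mem_nhds hpos)
  constructor
  · filter_upwards [nhdsWithin_mono t (fun s (hs : s < t) => hs.ne) h1, self_mem_nhdsWithin]
      with s hs (hst : s < t)
    rw [slope_def_field, h0, sub_zero] at hs
    by_contra! hc
    exact hs.not_ge (div_nonpos_of_nonneg_of_nonpos hc (by linarith))
  · filter_upwards [nhdsWithin_mono t (fun s (hs : t < s) => hs.ne') h1, self_mem_nhdsWithin]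
      with s hs (hst : t < s)
    rw [slope_def_field, h0, sub_zero] at hs
    by_contra! hc
    exact hs.not_ge (div_nonpos_of_nonpos_of_nonneg hc (by linarith))

/-- If ν ≠ ν', then ⟨ν, ν'⟩ < 1, so moving along ν' - ν decreases the first defining function to
first order and increases the second. Nearby points on this ray would lie both inside and outside Ω.
-/
lemma IsOutwardNormal.unique {ν' : EuclideanSpace ℝ (Fin n)} (h : IsOutwardNormal Ω x ν)
    (h' : IsOutwardNormal Ω x ν') : ν = ν' := by
  have hn := h.norm_eq_one
  have hn' := h'.norm_eq_one
  obtain ⟨ρ, hρ, hx, h0, hΩ, hν⟩ := h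
  obtain ⟨ρ', hρ', hx', h0', hΩ', hν'⟩ := h'
  by_contra hne
  have hlt : inner ℝ ν ν' < 1 := by
    refine lt_of_le_of_ne (by simpa [hn, hn'] using real_inner_le_norm ν ν') fun h => hne ?_
    exact (inner_eq_one_iff_of_norm_eq_one hn hn').1 h
  have hpos : 0 < ‖gradient ρ x‖ := norm_pos_iff.2 h0
  have hpos' : 0 < ‖gradient ρ' x‖ := norm_pos_iff.2 h0'
  have e1 : gradient ρ x = ‖gradient ρ x‖ • ν := by
    rw [hν, smul_smul, mul_inv_cancel₀ hpos.ne', one_smul]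
  have e2 : gradient ρ' x = ‖gradient ρ' x‖ • ν' := by
    rw [hν', smul_smul, mul_inv_cancel₀ hpos'.ne', one_smul]
  have d1 := (hasDerivAt_ray hρ (ν - ν')).congr_deriv (g' := ‖gradient ρ x‖ * (1 - inner ℝ ν ν'))
    (by conv_lhs => rw [e1]
        rw [inner_smul_left, inner_sub_right, real_inner_self_eq_norm_sq, hn]; simp)
  have d2 := (hasDerivAt_ray hρ' (ν' - ν)).congr_deriv
    (g' := ‖gradient ρ' x‖ * (1 - inner ℝ ν ν'))
    (by conv_lhs => rw [e2]
        rw [inner_smul_left, inner_sub_right, real_inner_self_eq_norm_sq, hn',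
          real_inner_comm]; simp)
  have p1 := (eventually_pos_of_hasDerivAt d1 (by simpa using hx)
    (mul_pos hpos (by linarith))).1
  have p2 := (eventually_pos_of_hasDerivAt d2 (by simpa using hx')
    (mul_pos hpos' (by linarith))).2
  have hcont : Tendsto (fun s : ℝ => x + s • (ν - ν')) (𝓝[<] 0) (𝓝 x) := by
    have : Continuous fun s : ℝ => x + s • (ν - ν') := by fun_prop
    simpa using (this.tendsto 0).mono_left nhdsWithin_le_nhds
  have hneg : Tendsto (fun s : ℝ => -s) (𝓝[<] 0) (𝓝[>] 0) := by
    simpa using tendsto_neg_nhdsLT (a := (0 : ℝ))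
  obtain ⟨s, h1, h2, h3, h4⟩ := (p1.and ((hneg.eventually p2).and
    ((hcont.eventually hΩ).and (hcont.eventually hΩ')))).exists
  have h5 : x + (-s) • (ν' - ν) = x + s • (ν - ν') := by
    rw [neg_smul, ← smul_neg, neg_sub]
  rw [h5] at h2
  exact (h4.1 (h3.2 h1)).not_gt h2

lemma outwardNormal_eq (h : IsOutwardNormal Ω x ν) : outwardNormal Ω x = ν :=
  (isOutwardNormal_outwardNormal ⟨ν, h⟩).unique h

/-- Where ρ > 0, this persists nearby by continuity, so no points of Ω accumulate there. -/
lemma eventually_nonpos_of_mem_closure {ρ : EuclideanSpace ℝ (Fin n) → ℝ}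
    (hρ : ContDiffAt ℝ 1 ρ x) (hΩ : ∀ᶠ y in 𝓝 x, (y ∈ Ω ↔ ρ y < 0)) :
    ∀ᶠ y in 𝓝 x, y ∈ closure Ω → ρ y ≤ 0 := by
  filter_upwards [hΩ.eventually_nhds, hρ.eventually (by norm_num)] with y hy hc hcl
  by_contra! hpos
  obtain ⟨z, hz, hz', hz''⟩ := (mem_closure_iff_frequently.1 hcl).and_eventually
    (hy.and (hc.continuousAt.eventually (lt_mem_nhds hpos))) |>.exists
  exact (hz'.1 hz).not_gt hz''

/-- One defining function serves all boundary points near `x`. Hence the regular boundary is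
relatively open in the boundary and the normal is continuous on it. -/
lemma eventually_isOutwardNormal (hO : IsOpen Ω) {ρ : EuclideanSpace ℝ (Fin n) → ℝ}
    (hρ : ContDiffAt ℝ 1 ρ x) (h0 : gradient ρ x ≠ 0)
    (hΩ : ∀ᶠ y in 𝓝 x, (y ∈ Ω ↔ ρ y < 0)) :
    ∀ᶠ y in 𝓝 x, y ∈ frontier Ω →
      ρ y = 0 ∧ IsOutwardNormal Ω y (‖gradient ρ y‖⁻¹ • gradient ρ y) := by
  filter_upwards [hΩ.eventually_nhds, hρ.eventually (by norm_num),
    eventually_nonpos_of_mem_closure hρ hΩ, (continuousAt_gradient hρ).eventually_ne h0]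
    with y hy hc hle hne hfr
  have h1 : ρ y = 0 := by
    refine le_antisymm (hle hfr.1) (not_lt.1 fun hlt => ?_)
    have := hy.self_of_nhds.2 hlt
    rw [hO.frontier_eq] at hfr
    exact hfr.2 this
  exact ⟨h1, ρ, hc, h1, hne, hy, rfl⟩

lemma measurableSet_regularBoundary (hO : IsOpen Ω) : MeasurableSet (regularBoundary Ω) := by
  have h : IsOpen (regularBoundary Ω ∪ (frontier Ω)ᶜ) := by
    refine isOpen_iff_mem_nhds.2 fun x hx => ?_
    rcases hx with ⟨-, ν, ρ, hρ, -, h0, hΩ, -⟩ | hx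
    · filter_upwards [eventually_isOutwardNormal hO hρ h0 hΩ] with y hy
      by_cases hfr : y ∈ frontier Ω
      · exact Or.inl ⟨hfr, _, (hy hfr).2⟩
      · exact Or.inr hfr
    · exact mem_of_superset (isClosed_frontier.isOpen_compl.mem_nhds hx) subset_union_right
  have h2 : regularBoundary Ω = (regularBoundary Ω ∪ (frontier Ω)ᶜ) ∩ frontier Ω := by
    ext y
    exact ⟨fun h => ⟨Or.inl h, h.1⟩, fun h => h.1.resolve_right fun h' => h' h.2⟩
  rw [h2]
  exact h.measurableSet.inter isClosed_frontier.measurableSet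

lemma continuousOn_outwardNormal (hO : IsOpen Ω) :
    ContinuousOn (outwardNormal Ω) (regularBoundary Ω) := by
  rintro x hx
  obtain ⟨-, ν, ρ, hρ, -, h0, hΩ, -⟩ := id hx
  have h1 : ContinuousAt (fun y => ‖gradient ρ y‖⁻¹ • gradient ρ y) x :=
    ((continuousAt_gradient hρ).norm.inv₀ (norm_ne_zero_iff.2 h0)).smul (continuousAt_gradient hρ)
  have h2 : outwardNormal Ω =ᶠ[𝓝[regularBoundary Ω] x]
      fun y => ‖gradient ρ y‖⁻¹ • gradient ρ y := by
    filter_upwards [nhdsWithin_le_nhds (eventually_isOutwardNormal hO hρ h0 hΩ),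
      self_mem_nhdsWithin] with y hy hR
    exact outwardNormal_eq (hy hR.1).2
  exact h1.continuousWithinAt.congr_of_eventuallyEq_of_mem h2 hx

/-- Near a regular point the boundary is flat. -/
lemma exists_nhds_abs_inner_outwardNormal_le (hO : IsOpen Ω) (hx : x ∈ regularBoundary Ω) {ε : ℝ}
    (hε : 0 < ε) : ∃ U ∈ 𝓝 x, ∀ y ∈ U ∩ frontier Ω, ∀ z ∈ U ∩ frontier Ω,
      |inner ℝ (outwardNormal Ω x) (y - z)| ≤ ε * ‖y - z‖ := by
  have hν := isOutwardNormal_outwardNormal hx.2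
  obtain ⟨ρ, hρ, -, h0, hΩ, hν⟩ := hν
  have hpos : 0 < ‖gradient ρ x‖ := norm_pos_iff.2 h0
  have h1 := (hasStrictFDerivAt_gradient hρ).isLittleO.bound (mul_pos hε hpos)
  rw [nhds_prod_eq] at h1
  obtain ⟨V, hV, hV'⟩ := eventually_prod_self_iff (r := fun y z =>
    ‖ρ y - ρ z - innerSL ℝ (gradient ρ x) (y - z)‖ ≤ ε * ‖gradient ρ x‖ * ‖y - z‖) |>.1 h1
  refine ⟨V ∩ {y | y ∈ frontier Ω → ρ y = 0}, inter_mem hV ?_, ?_⟩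
  · filter_upwards [eventually_isOutwardNormal hO hρ h0 hΩ] with y hy h using (hy h).1
  · rintro y ⟨⟨hy, hy0⟩, hyf⟩ z ⟨⟨hz, hz0⟩, hzf⟩
    have h2 := hV' y hy z hz
    simp only [hy0 hyf, hz0 hzf, sub_self, zero_sub, norm_neg, innerSL_apply_apply,
      Real.norm_eq_abs] at h2
    rw [hν, inner_smul_left, abs_mul]
    simp only [conj_trivial, abs_inv, abs_norm]
    rw [inv_mul_le_iff₀ hpos]
    linarith

end Normal

/-! ### How a coordinate line crosses the boundary -/

section NormalLine

variable {m : ℕ} {k : Fin (m + 1)} {Ω : Set (EuclideanSpace ℝ (Fin (m + 1)))}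
  {y : EuclideanSpace ℝ (Fin m)} {t : ℝ}

/-- Take for `g` the defining function restricted to the line; its derivative is the k-th component
of the gradient, that is ‖∇ρ‖ ν_k. The sign of ν_k thus decides on which side of `t` the line is
inside Ω. -/
lemma exists_hasDerivAt_line_of_mem_regularBoundary
    (h : insertCoord k y t ∈ regularBoundary Ω) :
    ∃ g : ℝ → ℝ, ∃ c > 0, HasDerivAt g (c * outwardNormal Ω (insertCoord k y t) k) t ∧ g t = 0 ∧
      (∀ᶠ s in 𝓝 t, (insertCoord k y s ∈ Ω ↔ g s < 0)) ∧
      ∀ᶠ s in 𝓝 t, insertCoord k y s ∈ closure Ω → g s ≤ 0 := by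
  obtain ⟨ρ, hρ, hx, h0, hΩ, hν⟩ := isOutwardNormal_outwardNormal h.2
  have hpos : 0 < ‖gradient ρ (insertCoord k y t)‖ := norm_pos_iff.2 h0
  have hcont := (continuous_insertCoord_right k y).tendsto t
  refine ⟨fun s => ρ (insertCoord k y s), _, hpos, ?_, hx, hcont.eventually hΩ,
    hcont.eventually (eventually_nonpos_of_mem_closure hρ hΩ)⟩
  have h1 := hasDerivAt_ray hρ (EuclideanSpace.single k (1 : ℝ))
  have h2 : HasDerivAt (fun s : ℝ => s - t) 1 t := (hasDerivAt_id t).sub_const t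
  rw [show (0 : ℝ) = t - t by simp] at h1
  have h3 := HasDerivAt.comp (h₂ := fun s : ℝ => ρ (insertCoord k y t + s • EuclideanSpace.single k (1 : ℝ)))
    (h := fun s => s - t) t h1 h2
  refine (h3.congr_of_eventuallyEq (Eventually.of_forall fun s => ?_)).congr_deriv ?_
  · simp only [Function.comp_apply]
    rw [insertCoord_eq_add k y t s]
    congr 2
    ext i
    simp
  · rw [hν, EuclideanSpace.inner_single_right]
    simp [mul_inv_cancel_left₀ hpos.ne']

lemma line_of_outwardNormal_pos (h : insertCoord k y t ∈ regularBoundary Ω)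
    (hpos : 0 < outwardNormal Ω (insertCoord k y t) k) :
    (∀ᶠ s in 𝓝[<] t, insertCoord k y s ∈ Ω) ∧ ∀ᶠ s in 𝓝[>] t, insertCoord k y s ∉ closure Ω := by
  obtain ⟨g, c, hc, hg, h0, h1, h2⟩ := exists_hasDerivAt_line_of_mem_regularBoundary h
  have h3 := eventually_pos_of_hasDerivAt hg h0 (mul_pos hc hpos)
  constructor
  · filter_upwards [h3.1, nhdsWithin_le_nhds h1] with s hs hs' using hs'.2 hs
  · filter_upwards [h3.2, nhdsWithin_le_nhds h2] with s hs hs' hcl using (hs' hcl).not_gt hs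

lemma line_of_outwardNormal_neg (h : insertCoord k y t ∈ regularBoundary Ω)
    (hneg : outwardNormal Ω (insertCoord k y t) k < 0) :
    (∀ᶠ s in 𝓝[>] t, insertCoord k y s ∈ Ω) ∧ ∀ᶠ s in 𝓝[<] t, insertCoord k y s ∉ closure Ω := by
  obtain ⟨g, c, hc, hg, h0, h1, h2⟩ := exists_hasDerivAt_line_of_mem_regularBoundary h
  have h3 := eventually_pos_of_hasDerivAt hg.neg (by simp [h0])
    (neg_pos.2 (mul_neg_of_pos_of_neg hc hneg))
  simp only [Pi.neg_apply, neg_lt_zero, neg_pos] at h3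
  constructor
  · filter_upwards [h3.2, nhdsWithin_le_nhds h1] with s hs hs' using hs'.2 hs
  · filter_upwards [h3.1, nhdsWithin_le_nhds h2] with s hs hs' hcl using (hs' hcl).not_gt hs

end NormalLine

/-! ### Rank-one stretchings and Hausdorff measure under Lipschitz maps -/

section Stretch

variable {m : ℕ}

/-- The linear map `y ↦ y + c ⟨e, y⟩ e` of `ℝ^m`. -/
def stretch (e : EuclideanSpace ℝ (Fin m)) (c : ℝ) :
    EuclideanSpace ℝ (Fin m) →ₗ[ℝ] EuclideanSpace ℝ (Fin m) :=
  LinearMap.transvection (c • (innerSL ℝ e).toLinearMap) e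

lemma stretch_apply (e : EuclideanSpace ℝ (Fin m)) (c : ℝ) (y : EuclideanSpace ℝ (Fin m)) :
    stretch e c y = y + (c * inner ℝ e y) • e := by
  simp [stretch, LinearMap.transvection.apply]

lemma det_stretch (e : EuclideanSpace ℝ (Fin m)) (c : ℝ) :
    LinearMap.det (stretch e c) = 1 + c * ‖e‖ ^ 2 := by
  rw [stretch, LinearMap.transvection.det]
  simp

lemma norm_sq_stretch (e : EuclideanSpace ℝ (Fin m)) (c : ℝ) (y : EuclideanSpace ℝ (Fin m)) :
    ‖stretch e c y‖ ^ 2 = ‖y‖ ^ 2 + (2 * c + c ^ 2 * ‖e‖ ^ 2) * inner ℝ e y ^ 2 := by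
  rw [stretch_apply, norm_add_sq_real, norm_smul, inner_smul_right, real_inner_comm,
    mul_pow, Real.norm_eq_abs, sq_abs]
  ring

lemma euclideanHausdorffMeasure_image_le {X Y : Type*} [EMetricSpace X] [MeasurableSpace X]
    [BorelSpace X] [EMetricSpace Y] [MeasurableSpace Y] [BorelSpace Y] {K : NNReal} {f : X → Y}
    {s : Set X} (h : LipschitzOnWith K f s) (d : ℕ) :
    μHE[d] (f '' s) ≤ (K : ℝ≥0∞) ^ d * μHE[d] s := by
  have h1 := h.hausdorffMeasure_image_le (d := d) (Nat.cast_nonneg _)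
  rw [ENNReal.rpow_natCast] at h1
  simp only [Measure.euclideanHausdorffMeasure_def, Measure.smul_apply, ENNReal.smul_def,
    smul_eq_mul]
  rw [mul_left_comm]
  gcongr

lemma volume_image_le_of_norm_sub_le {X : Type*} [NormedAddCommGroup X]
    [MeasurableSpace X] [BorelSpace X] {K : NNReal} {f : X → EuclideanSpace ℝ (Fin m)} {s : Set X}
    (h : ∀ x ∈ s, ∀ y ∈ s, ‖f x - f y‖ ≤ K * ‖x - y‖) :
    volume (f '' s) ≤ (K : ℝ≥0∞) ^ m * μHE[m] s := by
  rw [← EuclideanSpace.euclideanHausdorffMeasure_eq_volume]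
  refine euclideanHausdorffMeasure_image_le (LipschitzOnWith.of_dist_le_mul fun x hx y hy => ?_) m
  rw [dist_eq_norm, dist_eq_norm]; exact h x hx y hy

/-- The lower bound on distances makes `f` injective on `s` with a Lipschitz inverse, whose image of
`f '' s` is `s`. -/
lemma le_volume_image_of_norm_sub_le {X : Type*} [NormedAddCommGroup X]
    [MeasurableSpace X] [BorelSpace X] {K : NNReal} {f : X → EuclideanSpace ℝ (Fin m)} {s : Set X}
    (h : ∀ x ∈ s, ∀ y ∈ s, ‖x - y‖ ≤ K * ‖f x - f y‖) :
    μHE[m] s ≤ (K : ℝ≥0∞) ^ m * volume (f '' s) := by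
  have : Nonempty X := ⟨0⟩
  have hinj : InjOn f s := fun x hx y hy hxy => by
    have := h x hx y hy
    rw [hxy, sub_self, norm_zero, mul_zero] at this
    exact sub_eq_zero.1 (norm_le_zero_iff.1 this)
  have himg : Function.invFunOn f s '' (f '' s) = s := by
    rw [hinj.invFunOn_image subset_rfl]
  rw [← EuclideanSpace.euclideanHausdorffMeasure_eq_volume]
  conv_lhs => rw [← himg]
  refine euclideanHausdorffMeasure_image_le (LipschitzOnWith.of_dist_le_mul ?_) m
  rintro _ ⟨x, hx, rfl⟩ _ ⟨y, hy, rfl⟩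
  rw [hinj.leftInvOn_invFunOn hx, hinj.leftInvOn_invFunOn hy, dist_eq_norm, dist_eq_norm]
  exact h x hx y hy

lemma volume_image_dropCoord_le (k : Fin (m + 1)) (s : Set (EuclideanSpace ℝ (Fin (m + 1)))) :
    volume (dropCoord k '' s) ≤ μHE[m] s := by
  have h := volume_image_le_of_norm_sub_le (K := 1) (f := dropCoord k) (s := s)
    fun x _ y _ => by
      rw [← map_sub, NNReal.coe_one, one_mul]
      exact norm_dropCoord_le k _
  simpa using h

end Stretch

/-! ### Local area distortion of the projection -/

section Flat

variable {m : ℕ} (k : Fin (m + 1))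

lemma le_mul_of_abs_sq_sub_sq_le {N D η : ℝ} (hN : 0 ≤ N) (hD : 0 ≤ D) (hη : 1 < η)
    (h : |N ^ 2 - D ^ 2| ≤ (1 - (η ^ 2)⁻¹) * D ^ 2) : N ≤ η * D ∧ D ≤ η * N := by
  obtain ⟨b1, b2⟩ := abs_le.1 h
  have hη2 : 1 < η ^ 2 := by nlinarith
  have hinv : η ^ 2 * (η ^ 2)⁻¹ = 1 := mul_inv_cancel₀ (by positivity)
  have hinv0 : 0 < (η ^ 2)⁻¹ := by positivity
  have hinv1 : (η ^ 2)⁻¹ < 1 := inv_lt_one_of_one_lt₀ hη2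
  constructor
  · refine le_of_sq_le_sq ?_ (by positivity)
    have h1 : 2 - (η ^ 2)⁻¹ ≤ η ^ 2 := by nlinarith
    calc N ^ 2 ≤ (2 - (η ^ 2)⁻¹) * D ^ 2 := by linarith
      _ ≤ η ^ 2 * D ^ 2 := by gcongr
      _ = _ := by ring
  · refine le_of_sq_le_sq ?_ (by positivity)
    calc D ^ 2 = η ^ 2 * ((η ^ 2)⁻¹ * D ^ 2) := by rw [← mul_assoc, hinv, one_mul]
      _ ≤ η ^ 2 * N ^ 2 := by gcongr; linarith
      _ = _ := by ring

/-- A nearly flat set is mapped to `ℝ^m` with distances almost preserved, by the projection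
along the `k`-th axis followed by the stretching that makes up for the inclination. -/
lemma norm_stretch_dropCoord_bounds {ν d : EuclideanSpace ℝ (Fin (m + 1))} {ε η : ℝ}
    (hν : ‖ν‖ = 1) (hk : ν k ≠ 0) (hε0 : 0 ≤ ε) (hε1 : ε ≤ 1) (hη : 1 < η)
    (hε : 3 * ε ≤ ν k ^ 2 * (1 - (η ^ 2)⁻¹)) (hd : |inner ℝ ν d| ≤ ε * ‖d‖) :
    ‖stretch (dropCoord k ν) (|ν k| * (1 + |ν k|))⁻¹ (dropCoord k d)‖ ≤ η * ‖d‖ ∧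
    ‖d‖ ≤ η * ‖stretch (dropCoord k ν) (|ν k| * (1 + |ν k|))⁻¹ (dropCoord k d)‖ := by
  set a := |ν k| with ha
  have ha0 : 0 < a := abs_pos.2 hk
  have ha2 : ν k ^ 2 = a ^ 2 := (sq_abs _).symm
  have h1 := norm_sq_eq_dropCoord k ν
  have h2 := norm_sq_eq_dropCoord k d
  have h3 := inner_eq_dropCoord k ν d
  rw [hν] at h1
  have hN := norm_sq_stretch (dropCoord k ν) (a * (1 + a))⁻¹ (dropCoord k d)
  set N := ‖stretch (dropCoord k ν) (a * (1 + a))⁻¹ (dropCoord k d)‖ with hNdef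
  have e1 : ‖dropCoord k ν‖ ^ 2 = 1 - a ^ 2 := by rw [← ha2]; linarith
  have e2 : inner ℝ (dropCoord k ν) (dropCoord k d) = inner ℝ ν d - ν k * d k := by linarith
  -- The constant 1 / (a (1 + a)) makes the stretching factor along the projected normal equal to
  -- 1/a. For d orthogonal to ν the inner product of the projections is -ν_k d_k, so the gain in
  -- squared length is d_k², exactly what the projection loses; in general the error is governed by
  -- ⟨ν, d⟩.
  have e3 : 2 * (a * (1 + a))⁻¹ + ((a * (1 + a))⁻¹) ^ 2 * (1 - a ^ 2) = (a ^ 2)⁻¹ := by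
    field_simp; ring
  rw [e1, e2, e3] at hN
  set i := inner ℝ ν d
  have hdk : |d k| ≤ ‖d‖ := by
    refine abs_le_of_sq_le_sq ?_ (norm_nonneg _)
    linarith [sq_nonneg ‖dropCoord k d‖]
  have ha1 : a ≤ 1 := by
    refine le_of_sq_le_sq ?_ zero_le_one
    linarith [sq_nonneg ‖dropCoord k ν‖]
  have hN' : N ^ 2 = ‖d‖ ^ 2 + (a ^ 2)⁻¹ * (i ^ 2 - 2 * i * (ν k * d k)) := by
    have : (a ^ 2)⁻¹ * (ν k ^ 2 * d k ^ 2) = d k ^ 2 := by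
      rw [ha2]; field_simp
    rw [hN]
    linear_combination this - h2
  have hbd : |i ^ 2 - 2 * i * (ν k * d k)| ≤ 3 * ε * ‖d‖ ^ 2 := by
    have p1 : |ν k * d k| ≤ ‖d‖ := by
      rw [abs_mul]
      calc a * |d k| ≤ 1 * ‖d‖ := by gcongr
        _ = ‖d‖ := one_mul _
    have p2 : |i| ^ 2 ≤ ε * ‖d‖ ^ 2 := by
      calc |i| ^ 2 ≤ (ε * ‖d‖) ^ 2 := by gcongr
        _ = ε * (ε * ‖d‖ ^ 2) := by ring
        _ ≤ ε * (1 * ‖d‖ ^ 2) := by gcongr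
        _ = _ := by ring
    calc |i ^ 2 - 2 * i * (ν k * d k)| ≤ |i ^ 2| + |2 * i * (ν k * d k)| := abs_sub _ _
      _ = |i| ^ 2 + 2 * (|i| * |ν k * d k|) := by
        rw [abs_mul, abs_mul, abs_pow, abs_two]; ring
      _ ≤ ε * ‖d‖ ^ 2 + 2 * ((ε * ‖d‖) * ‖d‖) := by gcongr
      _ = _ := by ring
  refine le_mul_of_abs_sq_sub_sq_le (norm_nonneg _) (norm_nonneg _) hη ?_
  rw [hN', add_sub_cancel_left, abs_mul, abs_of_pos (by positivity : 0 < (a ^ 2)⁻¹),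
    inv_mul_le_iff₀ (by positivity)]
  rw [ha2] at hε
  calc _ ≤ 3 * ε * ‖d‖ ^ 2 := hbd
    _ ≤ a ^ 2 * (1 - (η ^ 2)⁻¹) * ‖d‖ ^ 2 := by gcongr
    _ = _ := by ring

/-- The stretching has determinant 1 + (1 - a²) / (a (1 + a)) = 1/a with a = |ν_k|. Since the
stretched projection is almost an isometry on flat pieces, this is where the Jacobian |ν_k| arises.
-/
lemma volume_stretch_image {ν : EuclideanSpace ℝ (Fin (m + 1))} (hν : ‖ν‖ = 1) (hk : ν k ≠ 0)
    (s : Set (EuclideanSpace ℝ (Fin (m + 1)))) :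
    volume (dropCoord k '' s) = ENNReal.ofReal |ν k| * volume
      ((fun x => stretch (dropCoord k ν) (|ν k| * (1 + |ν k|))⁻¹ (dropCoord k x)) '' s) := by
  have ha0 : 0 < |ν k| := abs_pos.2 hk
  have h1 := norm_sq_eq_dropCoord k ν
  rw [hν] at h1
  have e1 : ‖dropCoord k ν‖ ^ 2 = 1 - |ν k| ^ 2 := by rw [sq_abs]; linarith
  rw [← image_image (stretch (dropCoord k ν) (|ν k| * (1 + |ν k|))⁻¹) (dropCoord k),
    Measure.addHaar_image_linearMap, det_stretch, e1, ← mul_assoc, ← ENNReal.ofReal_mul ha0.le]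
  have e2 : 1 + (|ν k| * (1 + |ν k|))⁻¹ * (1 - |ν k| ^ 2) = |ν k|⁻¹ := by
    field_simp; ring
  rw [e2, abs_of_pos (inv_pos.2 ha0), mul_inv_cancel₀ ha0.ne', ENNReal.ofReal_one, one_mul]

variable {k} {Ω : Set (EuclideanSpace ℝ (Fin (m + 1)))} {x : EuclideanSpace ℝ (Fin (m + 1))}

/-- Near a regular boundary point, where the normal is not perpendicular to the `k`-th axis, the
projection along this axis is injective on the boundary and changes areas by a factor close to
`|ν k|`. -/
lemma exists_nhds_volume_image_dropCoord (hO : IsOpen Ω) (hx : x ∈ regularBoundary Ω)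
    (hk : outwardNormal Ω x k ≠ 0) {η : NNReal} (hη : 1 < η) :
    ∃ U ∈ 𝓝 x, InjOn (dropCoord k) (U ∩ frontier Ω) ∧ ∀ s ⊆ U ∩ frontier Ω,
      volume (dropCoord k '' s) ≤
        ENNReal.ofReal |outwardNormal Ω x k| * ((η : ℝ≥0∞) ^ m * μHE[m] s) ∧
      ENNReal.ofReal |outwardNormal Ω x k| * μHE[m] s ≤
        (η : ℝ≥0∞) ^ m * volume (dropCoord k '' s) := by
  set ν := outwardNormal Ω x
  have hν : ‖ν‖ = 1 := (isOutwardNormal_outwardNormal hx.2).norm_eq_one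
  have hη' : (1 : ℝ) < η := by exact_mod_cast hη
  have hc : 0 < ν k ^ 2 * (1 - ((η : ℝ) ^ 2)⁻¹) := by
    refine mul_pos (by positivity) ?_
    have : ((η : ℝ) ^ 2)⁻¹ < 1 := inv_lt_one_of_one_lt₀ (by nlinarith)
    linarith
  set c := ν k ^ 2 * (1 - ((η : ℝ) ^ 2)⁻¹) with hcdef
  obtain ⟨U, hU, hflat⟩ := exists_nhds_abs_inner_outwardNormal_le hO hx
    (ε := min 1 (c / 3)) (lt_min one_pos (by linarith))
  have hb : ∀ y ∈ U ∩ frontier Ω, ∀ z ∈ U ∩ frontier Ω, _ := fun y hy z hz =>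
    norm_stretch_dropCoord_bounds k hν hk (le_min zero_le_one (by linarith)) (min_le_left _ _) hη'
      (by linarith [min_le_right 1 (c / 3)]) (hflat y hy z hz)
  simp only [map_sub] at hb
  refine ⟨U, hU, fun y hy z hz hyz => ?_, fun s hs => ?_⟩
  · have := (hb y hy z hz).2
    rw [hyz, sub_self, norm_zero, mul_zero] at this
    exact sub_eq_zero.1 (norm_le_zero_iff.1 this)
  · have h1 := volume_image_le_of_norm_sub_le (K := η) (s := s)
      (f := fun x => stretch (dropCoord k ν) (|ν k| * (1 + |ν k|))⁻¹ (dropCoord k x))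
      fun y hy z hz => (hb y (hs hy) z (hs hz)).1
    have h2 := le_volume_image_of_norm_sub_le (K := η) (s := s)
      (f := fun x => stretch (dropCoord k ν) (|ν k| * (1 + |ν k|))⁻¹ (dropCoord k x))
      fun y hy z hz => (hb y (hs hy) z (hs hz)).2
    rw [volume_stretch_image k hν hk s]
    constructor
    · gcongr
    · rw [mul_left_comm]; gcongr

/-- Near a regular boundary point where the normal is perpendicular to the `k`-th axis, the
projection along this axis makes areas small. -/
lemma exists_nhds_volume_image_dropCoord_le_mul (hO : IsOpen Ω) (hx : x ∈ regularBoundary Ω)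
    (hk : outwardNormal Ω x k = 0) {ε : NNReal} (hε : 0 < ε) :
    ∃ U ∈ 𝓝 x, ∀ s ⊆ U ∩ frontier Ω, volume (dropCoord k '' s) ≤ ε * ((2 : ℝ≥0∞) ^ m * μHE[m] s) := by
  set ν := outwardNormal Ω x
  have hν : ‖ν‖ = 1 := (isOutwardNormal_outwardNormal hx.2).norm_eq_one
  have hε' : (0 : ℝ) < ε := by exact_mod_cast hε
  obtain ⟨U, hU, hflat⟩ := exists_nhds_abs_inner_outwardNormal_le hO hx hε'
  have hν2 := norm_sq_eq_dropCoord k ν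
  rw [hν, hk] at hν2
  refine ⟨U, hU, fun s hs => ?_⟩
  -- Now the projected normal is a unit vector. Differences of points of `s` have a component of
  -- size at most ε‖d‖ along it, so stretching by 1/ε in this direction still gives a 2-Lipschitz
  -- map. Its determinant 1/ε produces the factor ε.
  have h1 := volume_image_le_of_norm_sub_le (K := 2) (s := s)
    (f := fun x => stretch (dropCoord k ν) ((ε : ℝ)⁻¹ - 1) (dropCoord k x)) fun y hy z hz => by
      have hd := hflat y (hs hy) z (hs hz)
      rw [← map_sub, ← map_sub]
      set d := y - z
      have h3 := inner_eq_dropCoord k ν d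
      rw [hk, zero_mul, add_zero] at h3
      refine le_of_sq_le_sq ?_ (by positivity)
      rw [norm_sq_stretch, ← h3, mul_pow]
      have h4 : ‖dropCoord k d‖ ^ 2 ≤ ‖d‖ ^ 2 := by gcongr; exact norm_dropCoord_le k d
      have h5 : inner ℝ ν d ^ 2 ≤ ε ^ 2 * ‖d‖ ^ 2 := by
        rw [← sq_abs, ← mul_pow]; gcongr
      have h6 : 2 * ((ε : ℝ)⁻¹ - 1) + ((ε : ℝ)⁻¹ - 1) ^ 2 * ‖dropCoord k ν‖ ^ 2 =
          ((ε : ℝ) ^ 2)⁻¹ - 1 := by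
        have : ‖dropCoord k ν‖ ^ 2 = 1 := by linarith
        rw [this]; field_simp; ring
      rw [h6, sub_mul, one_mul]
      have h7 : ((ε : ℝ) ^ 2)⁻¹ * inner ℝ ν d ^ 2 ≤ ‖d‖ ^ 2 := by
        rw [inv_mul_le_iff₀ (by positivity)]; exact h5
      norm_num
      nlinarith [sq_nonneg (inner ℝ ν d), sq_nonneg ‖d‖]
  rw [← image_image (stretch (dropCoord k ν) ((ε : ℝ)⁻¹ - 1)) (dropCoord k),
    Measure.addHaar_image_linearMap, det_stretch] at h1
  have h8 : 1 + ((ε : ℝ)⁻¹ - 1) * ‖dropCoord k ν‖ ^ 2 = (ε : ℝ)⁻¹ := by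
    have : ‖dropCoord k ν‖ ^ 2 = 1 := by linarith
    rw [this]; ring
  rw [h8, abs_of_pos (inv_pos.2 hε'), ENNReal.ofReal_inv_of_pos hε', ENNReal.ofReal_coe_nnreal] at h1
  have h9 : (ε : ℝ≥0∞) ≠ 0 := by exact_mod_cast hε.ne'
  rw [ENNReal.inv_mul_le_iff h9 ENNReal.coe_ne_top] at h1
  simpa using h1

end Flat

/-! ### Transversality of almost every line and the area formula -/

section AreaFormula

/-- A measurable set that is locally small (in the sense of a property `P` inherited by subsets)
is a disjoint union of countably many small measurable sets. -/
lemma exists_measurable_partition {X : Type*} [TopologicalSpace X] [SecondCountableTopology X]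
    [MeasurableSpace X] [OpensMeasurableSpace X] {S : Set X} (hS : MeasurableSet S)
    {P : Set X → Prop} (hP : ∀ A B, A ⊆ B → P B → P A) (h0 : P ∅)
    (h : ∀ x ∈ S, ∃ U ∈ 𝓝 x, P (U ∩ S)) :
    ∃ A : ℕ → Set X, (∀ i, MeasurableSet (A i)) ∧ Pairwise (Function.onFun Disjoint A) ∧
      ⋃ i, A i = S ∧ ∀ i, P (A i) := by
  have h' : ∀ x, ∃ U : Set X, IsOpen U ∧ (x ∈ S → x ∈ U) ∧ P (U ∩ S) := fun x => by
    by_cases hx : x ∈ S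
    · obtain ⟨U, hU, hPU⟩ := h x hx
      exact ⟨interior U, isOpen_interior, fun _ => mem_interior_iff_mem_nhds.2 hU,
        hP _ _ (inter_subset_inter_left _ interior_subset) hPU⟩
    · exact ⟨∅, isOpen_empty, fun h => absurd h hx, by rwa [empty_inter]⟩
  choose U hUo hUx hUP using h'
  obtain ⟨t, htS, htc, hcov⟩ := TopologicalSpace.countable_cover_nhdsWithin (f := U) (s := S)
    fun x hx => mem_nhdsWithin_of_mem_nhds ((hUo x).mem_nhds (hUx x hx))
  rcases t.eq_empty_or_nonempty with rfl | hne
  · have hSe : S = ∅ := subset_empty_iff.1 (by simpa using hcov)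
    exact ⟨fun _ => ∅, fun _ => MeasurableSet.empty, fun _ _ _ => disjoint_bot_left,
      by simp [hSe], fun _ => h0⟩
  · obtain ⟨f, rfl⟩ := htc.exists_eq_range hne
    refine ⟨disjointed fun i => U (f i) ∩ S,
      fun i => MeasurableSet.disjointed (fun i => (hUo _).measurableSet.inter hS) i,
      disjoint_disjointed _, ?_, fun i => hP _ _ (disjointed_subset _ i) (hUP _)⟩
    rw [iUnion_disjointed, ← iUnion_inter]
    refine inter_eq_right.2 (hcov.trans ?_)
    rw [biUnion_range]

variable {m : ℕ} {k : Fin (m + 1)} {Ω : Set (EuclideanSpace ℝ (Fin (m + 1)))}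

variable (k) in
/-- The part of the regular boundary on which the normal is not perpendicular to the `k`-th
axis. -/
def transversalBoundary (Ω : Set (EuclideanSpace ℝ (Fin (m + 1)))) :
    Set (EuclideanSpace ℝ (Fin (m + 1))) :=
  {x ∈ regularBoundary Ω | outwardNormal Ω x k ≠ 0}

lemma continuousOn_outwardNormal_apply (hO : IsOpen Ω) :
    ContinuousOn (fun x => outwardNormal Ω x k) (regularBoundary Ω) :=
  (PiLp.continuous_apply 2 (fun _ : Fin (m + 1) => ℝ) k).comp_continuousOn
    (continuousOn_outwardNormal hO)

lemma measurableSet_inter_preimage_of_continuousOn {X Y : Type*} [TopologicalSpace X]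
    [MeasurableSpace X] [OpensMeasurableSpace X] [TopologicalSpace Y] {f : X → Y} {S : Set X}
    (hS : MeasurableSet S) (hf : ContinuousOn f S) {V : Set Y} (hV : IsOpen V) :
    MeasurableSet (S ∩ f ⁻¹' V) := by
  obtain ⟨W, hW, h⟩ := continuousOn_iff'.1 hf V hV
  rw [inter_comm, h]
  exact hW.measurableSet.inter hS

lemma measurableSet_transversalBoundary (hO : IsOpen Ω) :
    MeasurableSet (transversalBoundary k Ω) :=
  measurableSet_inter_preimage_of_continuousOn (measurableSet_regularBoundary hO)
    (continuousOn_outwardNormal_apply (k := k) hO) isOpen_compl_singleton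

/-- Some component ν_j of the unit normal is nonzero. Near `x` the area is then controlled by the
volume of the projection along the j-th axis, which is bounded on a ball. -/
lemma exists_nhds_euclideanHausdorffMeasure_lt_top (hO : IsOpen Ω)
    {x : EuclideanSpace ℝ (Fin (m + 1))} (hx : x ∈ regularBoundary Ω) :
    ∃ U ∈ 𝓝 x, μHE[m] (U ∩ regularBoundary Ω) < ⊤ := by
  have hν : ‖outwardNormal Ω x‖ = 1 := (isOutwardNormal_outwardNormal hx.2).norm_eq_one
  obtain ⟨j, hj⟩ : ∃ j, outwardNormal Ω x j ≠ 0 := by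
    by_contra! h
    have : outwardNormal Ω x = 0 := by ext j; simpa using h j
    simp [this] at hν
  obtain ⟨U, hU, -, hU'⟩ := exists_nhds_volume_image_dropCoord (k := j) hO hx hj
    (η := 2) (by norm_num)
  refine ⟨U ∩ Metric.ball x 1, inter_mem hU (Metric.ball_mem_nhds x one_pos), ?_⟩
  have h1 := (hU' (U ∩ Metric.ball x 1 ∩ regularBoundary Ω)
    fun y hy => ⟨hy.1.1, hy.2.1⟩).2
  have h2 : volume (dropCoord j '' (U ∩ Metric.ball x 1 ∩ regularBoundary Ω)) < ⊤ := by
    refine Bornology.IsBounded.measure_lt_top ?_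
    refine (dropCoord j).lipschitz.isBounded_image ?_
    exact Metric.isBounded_ball.subset fun y hy => hy.1.2
  have h3 : ENNReal.ofReal |outwardNormal Ω x j| ≠ 0 := by simpa using hj
  by_contra! htop
  rw [top_le_iff] at htop
  rw [htop, ENNReal.mul_top h3, top_le_iff] at h1
  exact ENNReal.mul_ne_top (by finiteness) h2.ne h1

/-- Almost no line in direction `k` meets the regular boundary tangentially. -/
lemma volume_image_dropCoord_regularBoundary_diff (hO : IsOpen Ω) :
    volume (dropCoord k '' (regularBoundary Ω \ transversalBoundary k Ω)) = 0 := by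
  set Z := regularBoundary Ω \ transversalBoundary k Ω with hZ
  have hZm : MeasurableSet Z :=
    (measurableSet_regularBoundary hO).diff (measurableSet_transversalBoundary hO)
  have hZ0 : ∀ x ∈ Z, outwardNormal Ω x k = 0 := fun x hx => by
    by_contra h
    exact hx.2 ⟨hx.1, h⟩
  -- Pieces of finite area are needed so that ε times the area tends to 0. Each piece is then
  -- subdivided again, depending on ε.
  obtain ⟨A, hAm, -, hAZ, hAfin⟩ := exists_measurable_partition hZm
    (P := fun A => μHE[m] A < ⊤) (fun A B hAB hB => (measure_mono hAB).trans_lt hB) (by simp)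
    fun x hx => by
      obtain ⟨U, hU, hlt⟩ := exists_nhds_euclideanHausdorffMeasure_lt_top hO hx.1
      exact ⟨U, hU, (measure_mono (inter_subset_inter_right _ sdiff_subset)).trans_lt hlt⟩
  rw [← hAZ, image_iUnion]
  refine measure_iUnion_null fun i => ?_
  have hAiZ : A i ⊆ Z := hAZ ▸ subset_iUnion A i
  have key : ∀ ε : NNReal, 0 < ε → volume (dropCoord k '' A i) ≤ ε * ((2 : ℝ≥0∞) ^ m * μHE[m] (A i)) := by
    intro ε hε
    obtain ⟨B, hBm, hBd, hBA, hB⟩ := exists_measurable_partition (hAm i)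
      (P := fun B => ∀ s ⊆ B, volume (dropCoord k '' s) ≤ ε * ((2 : ℝ≥0∞) ^ m * μHE[m] s))
      (fun A B hAB hB s hs => hB s (hs.trans hAB)) (fun s hs => by simp [subset_empty_iff.1 hs])
      fun x hx => by
        obtain ⟨U, hU, hs⟩ := exists_nhds_volume_image_dropCoord_le_mul hO (hAiZ hx).1
          (hZ0 x (hAiZ hx)) hε
        exact ⟨U, hU, fun s hsU => hs s fun y hy => ⟨(hsU hy).1, (hAiZ (hsU hy).2).1.1⟩⟩
    rw [← hBA, image_iUnion, measure_iUnion hBd hBm, ← ENNReal.tsum_mul_left, ← ENNReal.tsum_mul_left]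
    exact (measure_iUnion_le _).trans (ENNReal.tsum_le_tsum fun j => hB j _ subset_rfl)
  have hfin : (2 : ℝ≥0∞) ^ m * μHE[m] (A i) ≠ ⊤ := ENNReal.mul_ne_top (by finiteness) (hAfin i).ne
  have hlim : Tendsto (fun ε : NNReal => (ε : ℝ≥0∞) * ((2 : ℝ≥0∞) ^ m * μHE[m] (A i)))
      (𝓝[>] 0) (𝓝 0) := by
    have := ENNReal.Tendsto.mul_const (b := (2 : ℝ≥0∞) ^ m * μHE[m] (A i))
      ((ENNReal.continuous_coe.tendsto (0 : NNReal)).mono_left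
        (nhdsWithin_le_nhds (s := Ioi 0))) (Or.inr hfin)
    simpa using this
  refine le_antisymm (ge_of_tendsto hlim ?_) zero_le
  filter_upwards [self_mem_nhdsWithin] with ε hε using key ε hε

/-- For almost every `y` the line over `y` in direction `k` meets the boundary transversally. -/
lemma ae_mem_transversalBoundary (hO : IsOpen Ω)
    (h : μHE[m] {x ∈ frontier Ω | ¬ ∃ ν, IsOutwardNormal Ω x ν} = 0) :
    ∀ᵐ y : EuclideanSpace ℝ (Fin m), ∀ t, insertCoord k y t ∈ frontier Ω →
      insertCoord k y t ∈ transversalBoundary k Ω := by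
  have h1 : volume (dropCoord k '' {x ∈ frontier Ω | ¬ ∃ ν, IsOutwardNormal Ω x ν}) = 0 :=
    le_antisymm ((volume_image_dropCoord_le k _).trans h.le) zero_le
  filter_upwards [compl_mem_ae_iff.2 h1,
    compl_mem_ae_iff.2 (volume_image_dropCoord_regularBoundary_diff (k := k) hO)] with y hy hy' t ht
  by_contra hc
  by_cases hr : insertCoord k y t ∈ regularBoundary Ω
  · exact hy' ⟨_, ⟨hr, hc⟩, by simp⟩
  · exact hy ⟨_, ⟨ht, fun hν => hr ⟨ht, hν⟩⟩, by simp⟩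

lemma exists_nnreal_pow_le {η : NNReal} (hη : 1 < η) (m : ℕ) : ∃ θ : NNReal, 1 < θ ∧ θ ^ m ≤ η := by
  have h : Tendsto (fun θ : NNReal => θ ^ m) (𝓝[>] 1) (𝓝 1) := by
    have : Continuous fun θ : NNReal => θ ^ m := by fun_prop
    simpa using (this.tendsto 1).mono_left (nhdsWithin_le_nhds (s := Ioi 1))
  obtain ⟨θ, h1, h2⟩ := ((h.eventually (gt_mem_nhds hη)).and self_mem_nhdsWithin).exists
  exact ⟨θ, h2, h1.le⟩

/-- The local area distortion with the constant |ν_k(x)| replaced by the variable density |ν_k|,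
which continuity keeps within a factor of its value at `x`. -/
lemma exists_nhds_lintegral_outwardNormal (hO : IsOpen Ω) {x : EuclideanSpace ℝ (Fin (m + 1))}
    (hx : x ∈ transversalBoundary k Ω) {η : NNReal} (hη : 1 < η) :
    ∃ U ∈ 𝓝 x, InjOn (dropCoord k) (U ∩ transversalBoundary k Ω) ∧
      ∀ s ⊆ U ∩ transversalBoundary k Ω, MeasurableSet s →
        volume (dropCoord k '' s) ≤ η * ∫⁻ x in s, ‖outwardNormal Ω x k‖ₑ ∂μHE[m] ∧
        ∫⁻ x in s, ‖outwardNormal Ω x k‖ₑ ∂μHE[m] ≤ η * volume (dropCoord k '' s) := by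
  -- Of the m + 1 factors θ, m come from the distortion of m-dimensional measure and one from the
  -- variation of ν_k.
  obtain ⟨θ, hθ1, hθ⟩ := exists_nnreal_pow_le hη (m + 1)
  obtain ⟨U, hU, hinj, hvol⟩ := exists_nhds_volume_image_dropCoord (k := k) hO hx.1 hx.2 hθ1
  have hθ0 : (θ : ℝ≥0∞) ≠ 0 := by exact_mod_cast (zero_lt_one.trans hθ1).ne'
  have hθ' : (θ : ℝ≥0∞) ^ (m + 1) ≤ η := by exact_mod_cast hθ
  set a : ℝ≥0∞ := ‖outwardNormal Ω x k‖ₑ with ha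
  have ha' : a = ENNReal.ofReal |outwardNormal Ω x k| := Real.enorm_eq_ofReal_abs _
  have ha0 : a ≠ 0 := by simpa [ha] using hx.2
  have hatop : a ≠ ⊤ := by simp [ha]
  have hcont : Tendsto (fun y => ‖outwardNormal Ω y k‖ₑ) (𝓝[regularBoundary Ω] x) (𝓝 a) :=
    ((continuousOn_outwardNormal_apply (k := k) hO) x hx.1).enorm
  have hlt : a < θ * a := by
    conv_lhs => rw [← one_mul a]
    exact (ENNReal.mul_lt_mul_iff_left ha0 hatop).2 (by exact_mod_cast hθ1)
  have hcont2 : Tendsto (fun y => θ * ‖outwardNormal Ω y k‖ₑ) (𝓝[regularBoundary Ω] x)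
      (𝓝 (θ * a)) := ENNReal.Tendsto.const_mul hcont (Or.inr ENNReal.coe_ne_top)
  have hev := (hcont.eventually (gt_mem_nhds hlt)).and (hcont2.eventually (lt_mem_nhds hlt))
  obtain ⟨V, hV, hV'⟩ := mem_nhdsWithin_iff_exists_mem_nhds_inter.1 hev
  refine ⟨U ∩ V, inter_mem hU hV, hinj.mono (show _ ⊆ U ∩ frontier Ω from fun y hy => ⟨hy.1.1, hy.2.1.1⟩), fun s hs hsm => ?_⟩
  have hb : ∀ y ∈ s, ‖outwardNormal Ω y k‖ₑ ≤ θ * a ∧ a ≤ θ * ‖outwardNormal Ω y k‖ₑ :=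
    fun y hy => by
      have := hV' (show y ∈ V ∩ regularBoundary Ω from ⟨(hs hy).1.2, (hs hy).2.1⟩)
      exact ⟨this.1.le, this.2.le⟩
  obtain ⟨v1, v2⟩ := hvol s fun y hy => ⟨(hs hy).1.1, (hs hy).2.1.1⟩
  rw [← ha'] at v1 v2
  have i1 : ∫⁻ x in s, ‖outwardNormal Ω x k‖ₑ ∂μHE[m] ≤ θ * (a * μHE[m] s) := by
    calc _ ≤ ∫⁻ _ in s, θ * a ∂μHE[m] := setLIntegral_mono' hsm fun y hy => (hb y hy).1
      _ = _ := by rw [setLIntegral_const, mul_assoc]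
  have i2 : a * μHE[m] s ≤ θ * ∫⁻ x in s, ‖outwardNormal Ω x k‖ₑ ∂μHE[m] := by
    calc _ = ∫⁻ _ in s, a ∂μHE[m] := (setLIntegral_const _ _).symm
      _ ≤ ∫⁻ x in s, θ * ‖outwardNormal Ω x k‖ₑ ∂μHE[m] :=
        setLIntegral_mono' hsm fun y hy => (hb y hy).2
      _ = _ := lintegral_const_mul' _ _ ENNReal.coe_ne_top
  constructor
  · calc _ ≤ (θ : ℝ≥0∞) ^ m * (a * μHE[m] s) := by rw [mul_left_comm]; exact v1
      _ ≤ (θ : ℝ≥0∞) ^ m * (θ * ∫⁻ x in s, ‖outwardNormal Ω x k‖ₑ ∂μHE[m]) := by gcongr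
      _ = (θ : ℝ≥0∞) ^ (m + 1) * ∫⁻ x in s, ‖outwardNormal Ω x k‖ₑ ∂μHE[m] := by
        rw [pow_succ, mul_assoc]
      _ ≤ _ := by gcongr
  · calc _ ≤ θ * (a * μHE[m] s) := i1
      _ ≤ θ * ((θ : ℝ≥0∞) ^ m * volume (dropCoord k '' s)) := by gcongr
      _ = (θ : ℝ≥0∞) ^ (m + 1) * volume (dropCoord k '' s) := by rw [pow_succ']; ring
      _ ≤ _ := by gcongr

lemma indicator_iUnion_eq_tsum {X : Type*} {A : ℕ → Set X}
    (hA : Pairwise (Function.onFun Disjoint A)) (x : X) :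
    (⋃ i, A i).indicator (fun _ => (1 : ℝ≥0∞)) x =
      ∑' i, (A i).indicator (fun _ => (1 : ℝ≥0∞)) x := by
  by_cases hx : x ∈ ⋃ i, A i
  · obtain ⟨i, hi⟩ := mem_iUnion.1 hx
    rw [indicator_of_mem hx, tsum_eq_single i, indicator_of_mem hi]
    exact fun j hj => indicator_of_notMem (Set.disjoint_left.1 (hA hj.symm) hi) _
  · rw [indicator_of_notMem hx, ENNReal.tsum_eq_zero.2]
    exact fun i => indicator_of_notMem (fun hi => hx (mem_iUnion_of_mem i hi)) _

lemma tsum_indicator_insertCoord {s : Set (EuclideanSpace ℝ (Fin (m + 1)))}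
    (hs : InjOn (dropCoord k) s) (y : EuclideanSpace ℝ (Fin m)) :
    ∑' t, s.indicator (fun _ => (1 : ℝ≥0∞)) (insertCoord k y t) =
      (dropCoord k '' s).indicator (fun _ => (1 : ℝ≥0∞)) y := by
  by_cases hy : y ∈ dropCoord k '' s
  · obtain ⟨x, hx, rfl⟩ := hy
    rw [indicator_of_mem (mem_image_of_mem _ hx), tsum_eq_single (x k)]
    · simp [hx]
    · intro t ht
      refine indicator_of_notMem (fun hmem => ht ?_) _
      have := hs hmem hx (by simp)
      simpa using congrArg (fun z : EuclideanSpace ℝ (Fin (m + 1)) => z k) this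
  · rw [indicator_of_notMem hy]
    refine ENNReal.tsum_eq_zero.2 fun t => indicator_of_notMem (fun hmem => hy ?_) _
    exact ⟨_, hmem, by simp⟩

/-- Cut `E` into countably many pieces on which the projection is injective and both sides agree up
to a factor η. The number of points of `E` over `y` is the sum of the indicators of the projected
pieces. The two sides do not depend on the cutting, so η → 1 gives equality. -/
lemma lintegral_tsum_indicator_insertCoord (hO : IsOpen Ω)
    {E : Set (EuclideanSpace ℝ (Fin (m + 1)))} (hE : MeasurableSet E)
    (hES : E ⊆ transversalBoundary k Ω) :
    (Measurable fun y => ∑' t, E.indicator (fun _ => (1 : ℝ≥0∞)) (insertCoord k y t)) ∧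
    ∫⁻ y, ∑' t, E.indicator (fun _ => (1 : ℝ≥0∞)) (insertCoord k y t) =
      ∫⁻ x in E, ‖outwardNormal Ω x k‖ₑ ∂μHE[m] := by
  have key : ∀ η : NNReal, 1 < η →
      (Measurable fun y => ∑' t, E.indicator (fun _ => (1 : ℝ≥0∞)) (insertCoord k y t)) ∧
      ∫⁻ y, ∑' t, E.indicator (fun _ => (1 : ℝ≥0∞)) (insertCoord k y t) ≤
        η * ∫⁻ x in E, ‖outwardNormal Ω x k‖ₑ ∂μHE[m] ∧
      ∫⁻ x in E, ‖outwardNormal Ω x k‖ₑ ∂μHE[m] ≤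
        η * ∫⁻ y, ∑' t, E.indicator (fun _ => (1 : ℝ≥0∞)) (insertCoord k y t) := by
    intro η hη
    obtain ⟨A, hAm, hAd, hAE, hA⟩ := exists_measurable_partition hE
      (P := fun B => InjOn (dropCoord k) B ∧ ∀ s ⊆ B, MeasurableSet s →
        volume (dropCoord k '' s) ≤ η * ∫⁻ x in s, ‖outwardNormal Ω x k‖ₑ ∂μHE[m] ∧
        ∫⁻ x in s, ‖outwardNormal Ω x k‖ₑ ∂μHE[m] ≤ η * volume (dropCoord k '' s))
      (fun A B hAB hB => ⟨hB.1.mono hAB, fun s hs => hB.2 s (hs.trans hAB)⟩)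
      ⟨injOn_empty _, fun s hs _ => by simp [subset_empty_iff.1 hs]⟩
      fun x hx => by
        obtain ⟨U, hU, hinj, hs⟩ := exists_nhds_lintegral_outwardNormal hO (hES hx) hη
        exact ⟨U, hU, hinj.mono (inter_subset_inter_right _ hES),
          fun s hsU => hs s (hsU.trans (inter_subset_inter_right _ hES))⟩
    have hpm : ∀ i, MeasurableSet (dropCoord k '' A i) := fun i =>
      (hAm i).image_of_continuousOn_injOn (dropCoord k).continuous.continuousOn (hA i).1
    have h1 : ∀ y, ∑' t, E.indicator (fun _ => (1 : ℝ≥0∞)) (insertCoord k y t) =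
        ∑' i, (dropCoord k '' A i).indicator (fun _ => (1 : ℝ≥0∞)) y := fun y => by
      simp_rw [← tsum_indicator_insertCoord (hA _).1, ← hAE]
      rw [ENNReal.tsum_comm]
      refine tsum_congr fun t => ?_
      exact indicator_iUnion_eq_tsum hAd _
    have h2 : ∫⁻ y, ∑' t, E.indicator (fun _ => (1 : ℝ≥0∞)) (insertCoord k y t) =
        ∑' i, volume (dropCoord k '' A i) := by
      simp_rw [h1]
      rw [lintegral_tsum fun i => (measurable_const.indicator (hpm i)).aemeasurable]
      exact tsum_congr fun i => lintegral_indicator_one (hpm i)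
    have h3 : ∫⁻ x in E, ‖outwardNormal Ω x k‖ₑ ∂μHE[m] =
        ∑' i, ∫⁻ x in A i, ‖outwardNormal Ω x k‖ₑ ∂μHE[m] := by
      rw [← hAE, lintegral_iUnion hAm hAd]
    refine ⟨?_, ?_, ?_⟩
    · simp_rw [h1]
      exact Measurable.tsum fun i => measurable_const.indicator (hpm i)
    · rw [h2, h3, ← ENNReal.tsum_mul_left]
      exact ENNReal.tsum_le_tsum fun i => ((hA i).2 _ subset_rfl (hAm i)).1
    · rw [h2, h3, ← ENNReal.tsum_mul_left]
      exact ENNReal.tsum_le_tsum fun i => ((hA i).2 _ subset_rfl (hAm i)).2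
  have hle : ∀ a b : ℝ≥0∞, (∀ η : NNReal, 1 < η → a ≤ η * b) → a ≤ b := fun a b h => by
    rcases eq_or_ne b ⊤ with rfl | hb
    · exact le_top
    have hlim : Tendsto (fun η : NNReal => (η : ℝ≥0∞) * b) (𝓝[>] 1) (𝓝 b) := by
      have := ENNReal.Tendsto.mul_const (b := b)
        ((ENNReal.continuous_coe.tendsto (1 : NNReal)).mono_left
          (nhdsWithin_le_nhds (s := Ioi 1))) (Or.inr hb)
      simpa using this
    refine ge_of_tendsto hlim ?_
    filter_upwards [self_mem_nhdsWithin] with η hη using h η hη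
  exact ⟨(key 2 (by norm_num)).1, le_antisymm (hle _ _ fun η hη => (key η hη).2.1)
    (hle _ _ fun η hη => (key η hη).2.2)⟩

/-- The area formula for the projection of the boundary along the `k`-th axis. -/
theorem lintegral_tsum_insertCoord (hO : IsOpen Ω) {f : EuclideanSpace ℝ (Fin (m + 1)) → ℝ≥0∞}
    (hf : Measurable f) :
    (Measurable fun y => ∑' t, (transversalBoundary k Ω).indicator f (insertCoord k y t)) ∧
    ∫⁻ y, ∑' t, (transversalBoundary k Ω).indicator f (insertCoord k y t) =
      ∫⁻ x in transversalBoundary k Ω, f x * ‖outwardNormal Ω x k‖ₑ ∂μHE[m] := by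
  have hS := measurableSet_transversalBoundary (k := k) hO
  set S := transversalBoundary k Ω with hSdef
  have hνm : AEMeasurable (fun x => ‖outwardNormal Ω x k‖ₑ) (μHE[m].restrict S) := by
    refine ContinuousOn.aemeasurable ?_ hS
    exact (((continuousOn_outwardNormal_apply (k := k) hO)).mono fun x hx => hx.1).enorm
  refine Measurable.ennreal_induction ?_ ?_ ?_ hf
  · intro c s hs
    have h1 := lintegral_tsum_indicator_insertCoord hO (hS.inter hs) inter_subset_left
    have h2 : ∀ y, ∑' t, S.indicator (s.indicator fun _ => c) (insertCoord k y t) =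
        c * ∑' t, (S ∩ s).indicator (fun _ => (1 : ℝ≥0∞)) (insertCoord k y t) := fun y => by
      rw [← ENNReal.tsum_mul_left]
      refine tsum_congr fun t => ?_
      rw [indicator_indicator]
      by_cases h : insertCoord k y t ∈ S ∩ s <;> simp [h]
    simp_rw [h2]
    refine ⟨h1.1.const_mul c, ?_⟩
    rw [lintegral_const_mul c h1.1, h1.2]
    have h3 : ∀ x, s.indicator (fun _ => c) x * ‖outwardNormal Ω x k‖ₑ =
        s.indicator (fun x => c * ‖outwardNormal Ω x k‖ₑ) x := fun x => by
      by_cases h : x ∈ s <;> simp [h]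
    simp_rw [h3]
    rw [lintegral_indicator hs, Measure.restrict_restrict hs, inter_comm S s,
      lintegral_const_mul'' c (hνm.mono_measure (Measure.restrict_mono inter_subset_right le_rfl))]
  · intro f g _ hf hg ihf ihg
    have h2 : ∀ y, ∑' t, S.indicator (f + g) (insertCoord k y t) =
        (∑' t, S.indicator f (insertCoord k y t)) + ∑' t, S.indicator g (insertCoord k y t) :=
      fun y => by rw [← ENNReal.tsum_add]; simp [indicator_add']
    simp_rw [h2]
    refine ⟨ihf.1.add ihg.1, ?_⟩
    rw [lintegral_add_left ihf.1, ihf.2, ihg.2, ← lintegral_add_left' (f := fun x => f x * ‖outwardNormal Ω x k‖ₑ)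
        (hf.aemeasurable.mul hνm)]
    simp [add_mul]
  · intro f hf hmono ih
    have h2 : ∀ y, ∑' t, S.indicator (fun x => ⨆ n, f n x) (insertCoord k y t) =
        ⨆ n, ∑' t, S.indicator (f n) (insertCoord k y t) := fun y => by
      -- The sum over the real parameter `t` is read as an integral for counting measure, so that
      -- monotone convergence applies.
      simp_rw [← lintegral_count]
      rw [← lintegral_iSup]
      · refine lintegral_congr fun t => ?_
        by_cases h : insertCoord k y t ∈ S <;> simp [h]
      · exact fun n => ((hf n).indicator hS).comp (continuous_insertCoord_right k y).measurable
      · exact fun i j hij t => indicator_le_indicator (hmono hij _)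
    simp_rw [h2]
    refine ⟨Measurable.iSup fun n => (ih n).1, ?_⟩
    rw [lintegral_iSup (fun n => (ih n).1) fun i j hij y =>
      ENNReal.tsum_le_tsum fun t => indicator_le_indicator (hmono hij _)]
    simp_rw [fun n => (ih n).2, ENNReal.iSup_mul]
    rw [lintegral_iSup' (f := fun n x => f n x * ‖outwardNormal Ω x k‖ₑ)
      (fun n => (hf n).aemeasurable.mul hνm)]
    exact ae_of_all _ fun x i j hij => mul_le_mul_left (hmono hij x) _

end AreaFormula

/-! ### The divergence inequality in one coordinate direction -/

section Divergence

variable {m : ℕ} {k : Fin (m + 1)} {Ω : Set (EuclideanSpace ℝ (Fin (m + 1)))} {α : ℝ}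

/-- The conformable density `∏_j y_j ^ (α - 1)`. -/
def conformableWeight {n : ℕ} (α : ℝ) (y : EuclideanSpace ℝ (Fin n)) : ℝ :=
  ∏ j, y j ^ (α - 1)

lemma measurable_conformableWeight {n : ℕ} :
    Measurable (conformableWeight α : EuclideanSpace ℝ (Fin n) → ℝ) := by
  unfold conformableWeight
  fun_prop

lemma conformableWeight_insertCoord (y : EuclideanSpace ℝ (Fin m)) (t : ℝ) :
    conformableWeight α (insertCoord k y t) = t ^ (α - 1) * conformableWeight α y := by
  simp [conformableWeight, Fin.prod_univ_succAbove _ k]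

lemma conformableNormal_eq (x : EuclideanSpace ℝ (Fin (m + 1))) :
    conformableNormal α Ω k x = outwardNormal Ω x k * conformableWeight α (dropCoord k x) := by
  rw [conformableNormal, Fin.univ_succAbove m k, Finset.erase_cons, Finset.prod_map]
  rfl

lemma IsCompatible.rpow_nonneg (hΩ : IsCompatible α Ω) {x : EuclideanSpace ℝ (Fin (m + 1))}
    (hx : x ∈ closure Ω) (j : Fin (m + 1)) : 0 ≤ x j ^ (α - 1) := by
  rcases hΩ.pos with rfl | hpos
  · simp
  · refine Real.rpow_nonneg ?_ _
    have hcl : IsClosed {x : EuclideanSpace ℝ (Fin (m + 1)) | 0 ≤ x j} :=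
      isClosed_le continuous_const (PiLp.continuous_apply 2 (fun _ : Fin (m + 1) => ℝ) j)
    exact closure_minimal (fun z hz => (hpos z hz j).le) hcl hx

lemma IsCompatible.conformableWeight_nonneg (hΩ : IsCompatible α Ω)
    {x : EuclideanSpace ℝ (Fin (m + 1))} (hx : x ∈ closure Ω) :
    0 ≤ conformableWeight α (dropCoord k x) :=
  Finset.prod_nonneg fun _ _ => hΩ.rpow_nonneg hx _

lemma aemeasurable_restrict_conformableVolume {n : ℕ} {Ω : Set (EuclideanSpace ℝ (Fin n))}
    {β : Type*} [MeasurableSpace β] {f : EuclideanSpace ℝ (Fin n) → β}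
    (hf : AEMeasurable f (volume.restrict Ω)) :
    AEMeasurable f ((conformableVolume n α).restrict Ω) :=
  hf.mono_ac ((withDensity_absolutelyContinuous _ _).restrict _)

/-- Conformable volume integrals by integration over lines. -/
lemma IsCompatible.setLIntegral_conformableVolume (hΩ : IsCompatible α Ω)
    {f : EuclideanSpace ℝ (Fin (m + 1)) → ℝ} (hf : AEMeasurable f (volume.restrict Ω)) :
    ∫⁻ x in Ω, ENNReal.ofReal (f x) ∂conformableVolume (m + 1) α =
      ∫⁻ y, ENNReal.ofReal (conformableWeight α y) *
        ∫⁻ t in insertCoord k y ⁻¹' Ω, ENNReal.ofReal (t ^ (α - 1) * f (insertCoord k y t)) := by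
  have hwm : Measurable fun x : EuclideanSpace ℝ (Fin (m + 1)) =>
      ENNReal.ofReal (conformableWeight α x) := measurable_conformableWeight.ennreal_ofReal
  have hΩm := hΩ.isOpen.measurableSet
  change ∫⁻ x in Ω, ENNReal.ofReal (f x)
    ∂(volume.withDensity fun x => ENNReal.ofReal (conformableWeight α x)) = _
  rw [restrict_withDensity hΩm, lintegral_withDensity_eq_lintegral_mul_non_measurable _ hwm
    (ae_of_all _ fun _ => ENNReal.ofReal_lt_top), ← lintegral_indicator hΩm,
    lintegral_eq_lintegral_insertCoord k ((aemeasurable_indicator_iff hΩm).2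
      (hwm.aemeasurable.mul hf.ennreal_ofReal))]
  refine lintegral_congr fun y => ?_
  rw [← lintegral_const_mul' _ _ ENNReal.ofReal_ne_top,
    ← lintegral_indicator ((continuous_insertCoord_right k y).measurable hΩm)]
  refine lintegral_congr fun t => ?_
  by_cases ht : insertCoord k y t ∈ Ω
  · rw [indicator_of_mem ht, indicator_of_mem (show t ∈ insertCoord k y ⁻¹' Ω from ht)]
    have h1 : 0 ≤ t ^ (α - 1) := by simpa using hΩ.rpow_nonneg (subset_closure ht) k
    have h2 : 0 ≤ conformableWeight α y := by
      simpa using hΩ.conformableWeight_nonneg (k := k) (subset_closure ht)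
    simp only [Pi.mul_apply]
    rw [conformableWeight_insertCoord, ENNReal.ofReal_mul h1, ENNReal.ofReal_mul h1]
    ring
  · rw [indicator_of_notMem ht, indicator_of_notMem (show t ∉ insertCoord k y ⁻¹' Ω from ht)]

lemma ae_aemeasurable_insertCoord (hO : IsOpen Ω) {f : EuclideanSpace ℝ (Fin (m + 1)) → ℝ}
    (hf : AEMeasurable f (volume.restrict Ω)) :
    ∀ᵐ y, AEMeasurable (fun t => f (insertCoord k y t))
      (volume.restrict (insertCoord k y ⁻¹' Ω)) := by
  have h1 : AEMeasurable (Ω.indicator f) := (aemeasurable_indicator_iff hO.measurableSet).2 hf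
  have h2 := (measurePreserving_insertCoord k).quasiMeasurePreserving.ae h1.ae_eq_mk
  filter_upwards [Measure.ae_ae_of_ae_prod h2] with y hy
  rw [← aemeasurable_indicator_iff ((continuous_insertCoord_right k y).measurable hO.measurableSet)]
  exact ⟨_, h1.measurable_mk.comp (continuous_insertCoord_right k y).measurable, hy⟩

lemma isBounded_preimage_insertCoord {s : Set (EuclideanSpace ℝ (Fin (m + 1)))}
    (hs : Bornology.IsBounded s) (y : EuclideanSpace ℝ (Fin m)) :
    Bornology.IsBounded (insertCoord k y ⁻¹' s) := by
  obtain ⟨r, hr⟩ := hs.subset_closedBall 0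
  refine (Metric.isBounded_closedBall (x := (0 : ℝ)) (r := r)).subset fun t ht => ?_
  have h1 := hr ht
  rw [mem_closedBall_zero_iff] at h1 ⊢
  have h2 := PiLp.norm_apply_le (insertCoord k y t) k
  rw [insertCoord_same] at h2
  exact h2.trans h1

/-- A line that meets the boundary only transversally meets it in finitely many points. -/
lemma finite_frontier_line (hO : IsOpen Ω) (hb : Bornology.IsBounded Ω) {y : EuclideanSpace ℝ (Fin m)}
    (hy : ∀ t, insertCoord k y t ∈ frontier Ω → insertCoord k y t ∈ transversalBoundary k Ω) :
    {t | insertCoord k y t ∈ frontier Ω}.Finite := by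
  have hcl : IsClosed {t | insertCoord k y t ∈ frontier Ω} :=
    isClosed_frontier.preimage (continuous_insertCoord_right k y)
  have hbd : Bornology.IsBounded {t | insertCoord k y t ∈ frontier Ω} :=
    isBounded_preimage_insertCoord (hb.closure.subset frontier_subset_closure) y
  -- Infinitely many crossings would accumulate at a boundary point by compactness. At a transversal
  -- crossing, however, the line is in Ω on one side and outside its closure on the other, so the
  -- crossing is isolated.
  by_contra hinf
  obtain ⟨t, ht, hacc⟩ := Set.Infinite.exists_accPt_of_subset_isCompact hinf
    (Metric.isCompact_of_isClosed_isBounded hcl hbd) subset_rfl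
  rw [accPt_iff_frequently_nhdsNE] at hacc
  refine hacc ?_
  have hint : ∀ {l : Filter ℝ}, (∀ᶠ s in l, insertCoord k y s ∈ Ω) →
      ∀ᶠ s in l, ¬ insertCoord k y s ∈ frontier Ω :=
    fun h => h.mono fun s hs hs' => hs'.2 (hO.interior_eq.symm ▸ hs)
  have hext : ∀ {l : Filter ℝ}, (∀ᶠ s in l, insertCoord k y s ∉ closure Ω) →
      ∀ᶠ s in l, ¬ insertCoord k y s ∈ frontier Ω :=
    fun h => h.mono fun s hs hs' => hs hs'.1
  obtain ⟨hr, hk⟩ := hy t ht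
  have : ∀ᶠ s in 𝓝[<] t ⊔ 𝓝[>] t, ¬ insertCoord k y s ∈ frontier Ω := by
    rcases hk.lt_or_gt with h | h
    · have := line_of_outwardNormal_neg hr h
      exact eventually_sup.2 ⟨hext this.2, hint this.1⟩
    · have := line_of_outwardNormal_pos hr h
      exact eventually_sup.2 ⟨hint this.1, hext this.2⟩
  rwa [nhdsLT_sup_nhdsGT] at this

/-- At a transversal crossing exactly one side of the line lies in Ω: the left side if ν_k > 0, the
right side if ν_k < 0. -/
lemma endpointTerm_insertCoord {b : EuclideanSpace ℝ (Fin (m + 1)) → ℝ}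
    {y : EuclideanSpace ℝ (Fin m)} {t : ℝ} (h : insertCoord k y t ∈ transversalBoundary k Ω) :
    endpointTerm (insertCoord k y ⁻¹' Ω) (fun s => b (insertCoord k y s)) t =
      Real.sign (outwardNormal Ω (insertCoord k y t) k) * b (insertCoord k y t) := by
  have hnot : ∀ {l : Filter ℝ} [l.NeBot], (∀ᶠ s in l, insertCoord k y s ∉ closure Ω) →
      insertCoord k y ⁻¹' Ω ∉ l := fun hl hmem => by
    obtain ⟨s, hs, hs'⟩ := (hl.and hmem).exists
    exact hs (subset_closure hs')
  rcases h.2.lt_or_gt with hneg | hpos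
  · obtain ⟨h1, h2⟩ := line_of_outwardNormal_neg h.1 hneg
    rw [endpointTerm, if_neg (hnot h2), if_pos (show _ ⁻¹' Ω ∈ _ from h1), Real.sign_of_neg hneg]
    ring
  · obtain ⟨h1, h2⟩ := line_of_outwardNormal_pos h.1 hpos
    rw [endpointTerm, if_pos (show _ ⁻¹' Ω ∈ _ from h1), if_neg (hnot h2), Real.sign_of_pos hpos]
    ring

/-- The part of a flux through the boundary that counts for lines in direction `k`, as an integral
over these lines. -/
lemma IsCompatible.lintegral_flux (hΩ : IsCompatible α Ω)
    {b : EuclideanSpace ℝ (Fin (m + 1)) → ℝ} (hb : ContinuousOn b (frontier Ω)) :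
    (Measurable fun y => ∑' t, (transversalBoundary k Ω).indicator (fun x =>
      ENNReal.ofReal (Real.sign (outwardNormal Ω x k) * b x) *
        ENNReal.ofReal (conformableWeight α (dropCoord k x))) (insertCoord k y t)) ∧
    ∫⁻ y, ∑' t, (transversalBoundary k Ω).indicator (fun x =>
      ENNReal.ofReal (Real.sign (outwardNormal Ω x k) * b x) *
        ENNReal.ofReal (conformableWeight α (dropCoord k x))) (insertCoord k y t) =
      ∫⁻ x in frontier Ω, ENNReal.ofReal (b x * conformableNormal α Ω k x) ∂μHE[m] := by
  set S := transversalBoundary k Ω with hSdef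
  have hS : MeasurableSet S := measurableSet_transversalBoundary hΩ.isOpen
  have hSf : S ⊆ frontier Ω := fun x hx => hx.1.1
  have hνc : ContinuousOn (fun x => outwardNormal Ω x k) S :=
    (continuousOn_outwardNormal_apply hΩ.isOpen).mono fun x hx => hx.1
  have hsign : ContinuousOn (fun x => Real.sign (outwardNormal Ω x k)) S := by
    have h1 : ContinuousOn (fun x => outwardNormal Ω x k / |outwardNormal Ω x k|) S :=
      hνc.div hνc.abs fun x hx => abs_ne_zero.2 hx.2
    refine h1.congr fun x hx => ?_
    have hx2 : outwardNormal Ω x k ≠ 0 := hx.2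
    rcases hx2.lt_or_gt with h | h
    · simp only []
      rw [Real.sign_of_neg h, abs_of_neg h, div_neg, div_self hx2]
    · simp only []
      rw [Real.sign_of_pos h, abs_of_pos h, div_self hx2]
  set F : EuclideanSpace ℝ (Fin (m + 1)) → ℝ≥0∞ := S.indicator fun x =>
    ENNReal.ofReal (Real.sign (outwardNormal Ω x k) * b x) *
        ENNReal.ofReal (conformableWeight α (dropCoord k x)) with hF
  have hFm : Measurable F := by
    have h1 : Measurable (S.indicator fun x =>
        ENNReal.ofReal (Real.sign (outwardNormal Ω x k) * b x)) := by
      classical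
      rw [← piecewise_eq_indicator]
      exact ContinuousOn.measurable_piecewise
        (ENNReal.continuous_ofReal.comp_continuousOn (hsign.mul (hb.mono hSf)))
        continuousOn_const hS
    have h2 : Measurable fun x : EuclideanSpace ℝ (Fin (m + 1)) =>
        ENNReal.ofReal (conformableWeight α (dropCoord k x)) :=
      (measurable_conformableWeight.comp (dropCoord k).continuous.measurable).ennreal_ofReal
    have h3 : F = fun x => (S.indicator fun x =>
        ENNReal.ofReal (Real.sign (outwardNormal Ω x k) * b x)) x *
          ENNReal.ofReal (conformableWeight α (dropCoord k x)) := by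
      ext x
      by_cases hx : x ∈ S <;> simp [hF, hx]
    rw [h3]
    exact h1.mul h2
  have hmain := lintegral_tsum_insertCoord (k := k) hΩ.isOpen hFm
  have hFF : S.indicator F = F := by rw [hF, indicator_indicator, inter_self]
  rw [← hSdef, hFF] at hmain
  refine ⟨hmain.1, hmain.2.trans ?_⟩
  rw [← lintegral_indicator hS, ← lintegral_indicator isClosed_frontier.measurableSet]
  -- Passing from the transversal part to the whole boundary costs nothing: the singular points form
  -- a null set, and elsewhere off the transversal part ν_k = 0.
  have hnull := compl_mem_ae_iff.2 hΩ.singular_null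
  refine lintegral_congr_ae ?_
  filter_upwards [hnull] with x hx
  by_cases hxf : x ∈ frontier Ω
  · have hxr : x ∈ regularBoundary Ω := ⟨hxf, by_contra fun h => hx ⟨hxf, h⟩⟩
    rw [indicator_of_mem hxf, conformableNormal_eq]
    by_cases hxS : x ∈ S
    · have hw := hΩ.conformableWeight_nonneg (k := k) (frontier_subset_closure hxf)
      rw [indicator_of_mem hxS, hF, indicator_of_mem hxS, Real.enorm_eq_ofReal_abs,
        ← ENNReal.ofReal_mul' hw, ← ENNReal.ofReal_mul' (abs_nonneg _)]
      congr 1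
      have h1 : Real.sign (outwardNormal Ω x k) * |outwardNormal Ω x k| = outwardNormal Ω x k := by
        rcases lt_trichotomy (outwardNormal Ω x k) 0 with h | h | h
        · rw [Real.sign_of_neg h, abs_of_neg h]; ring
        · rw [h]; simp
        · rw [Real.sign_of_pos h, abs_of_pos h]; ring
      calc _ = b x * ((Real.sign (outwardNormal Ω x k) * |outwardNormal Ω x k|) *
            conformableWeight α (dropCoord k x)) := by ring
        _ = _ := by rw [h1]
    · have h0 : outwardNormal Ω x k = 0 := by_contra fun h => hxS ⟨hxr, h⟩
      rw [indicator_of_notMem hxS, h0]; simp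
  · rw [indicator_of_notMem hxf, indicator_of_notMem fun h => hxf (hSf h)]

/-- The divergence theorem in one direction, as an inequality, on a compatible domain: the function
`b` need only be continuous and differentiable along the lines in direction `k`. -/
theorem IsCompatible.lintegral_add_flux_le (hΩ : IsCompatible α Ω)
    {b g h : EuclideanSpace ℝ (Fin (m + 1)) → ℝ} (hb : ContinuousOn b (frontier Ω))
    (hbl : ∀ y, ContinuousOn (fun t => b (insertCoord k y t)) (insertCoord k y ⁻¹' closure Ω))
    (hgm : AEMeasurable g (volume.restrict Ω)) (hhm : AEMeasurable h (volume.restrict Ω))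
    (hg : ∀ x ∈ Ω, 0 ≤ g x) (hh : ∀ x ∈ Ω, 0 ≤ h x)
    (hd : ∀ y t, insertCoord k y t ∈ Ω → ∃ D, HasDerivAt (fun s => b (insertCoord k y s)) D t ∧
      D ≤ t ^ (α - 1) * g (insertCoord k y t) - t ^ (α - 1) * h (insertCoord k y t)) :
    (∫⁻ x in Ω, ENNReal.ofReal (h x) ∂conformableVolume (m + 1) α) +
        ∫⁻ x in frontier Ω, ENNReal.ofReal (b x * conformableNormal α Ω k x) ∂μHE[m] ≤
      (∫⁻ x in Ω, ENNReal.ofReal (g x) ∂conformableVolume (m + 1) α) +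
        ∫⁻ x in frontier Ω, ENNReal.ofReal (-(b x * conformableNormal α Ω k x)) ∂μHE[m] := by
  obtain ⟨hpm, hpi⟩ := hΩ.lintegral_flux (k := k) hb
  obtain ⟨hnm, hni⟩ := hΩ.lintegral_flux (k := k) hb.neg
  simp only [Pi.neg_apply, mul_neg, neg_mul] at hnm hni
  rw [← hpi, ← hni, hΩ.setLIntegral_conformableVolume (k := k) hhm,
    hΩ.setLIntegral_conformableVolume (k := k) hgm, ← lintegral_add_right _ hpm,
    ← lintegral_add_right _ hnm]
  refine lintegral_mono_ae ?_
  filter_upwards [ae_mem_transversalBoundary hΩ.isOpen hΩ.singular_null,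
    ae_aemeasurable_insertCoord (k := k) hΩ.isOpen hgm,
    ae_aemeasurable_insertCoord (k := k) hΩ.isOpen hhm] with y hy hgy hhy
  have hfin := finite_frontier_line hΩ.isOpen hΩ.isBounded hy
  have hcont := continuous_insertCoord_right k y
  have hOb : Bornology.IsBounded (insertCoord k y ⁻¹' Ω) :=
    isBounded_preimage_insertCoord hΩ.isBounded y
  have htm : AEMeasurable (fun t : ℝ => t ^ (α - 1)) (volume.restrict (insertCoord k y ⁻¹' Ω)) := by
    fun_prop
  have ht0 : ∀ t ∈ insertCoord k y ⁻¹' Ω, 0 ≤ t ^ (α - 1) := fun t ht => by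
    simpa using hΩ.rpow_nonneg (subset_closure ht) k
  choose! D hD hDle using fun t => hd y t
  have key := lintegral_add_sum_endpointTerm_le (hΩ.isOpen.preimage hcont) hOb
    (F := fun t => b (insertCoord k y t)) (F' := D)
    ((hbl y).mono (hcont.closure_preimage_subset Ω)) hD (htm.mul hgy) (htm.mul hhy)
    (fun t ht => mul_nonneg (ht0 t ht) (hg _ ht)) (fun t ht => mul_nonneg (ht0 t ht) (hh _ ht))
    hDle hfin.toFinset (by
      rw [Finite.coe_toFinset]
      exact hcont.frontier_preimage_subset Ω)
  -- The function σ covers both parts of the flux at once: the identity for the positive part and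
  -- negation for the negative part.
  have hsum : ∀ σ : ℝ → ℝ, ∑' t, (transversalBoundary k Ω).indicator (fun x =>
      ENNReal.ofReal (σ (Real.sign (outwardNormal Ω x k) * b x)) *
        ENNReal.ofReal (conformableWeight α (dropCoord k x))) (insertCoord k y t) =
      ENNReal.ofReal (conformableWeight α y) * ∑ z ∈ hfin.toFinset, ENNReal.ofReal
        (σ (endpointTerm (insertCoord k y ⁻¹' Ω) (fun t => b (insertCoord k y t)) z)) := by
    intro σ
    rw [tsum_eq_sum (s := hfin.toFinset), Finset.mul_sum]
    · refine Finset.sum_congr rfl fun z hz => ?_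
      have hz' := hy z (hfin.mem_toFinset.1 hz)
      rw [indicator_of_mem hz', endpointTerm_insertCoord hz', dropCoord_insertCoord, mul_comm]
    · intro t ht
      exact indicator_of_notMem (fun hmem => ht (hfin.mem_toFinset.2 hmem.1.1)) _
  have hs1 := hsum id
  have hs2 := hsum fun r => -r
  simp only [id] at hs1
  simp only [hs1, hs2, ← mul_add]
  exact mul_le_mul' le_rfl key

end Divergence

/-! ### Hardy inequalities in one direction and their summation -/

section Hardy

/-- Summation of inequalities between nonnegative extended quantities with real boundary terms. -/
lemma EReal.sum_mul_add_sum_le {ι : Type*} [Fintype ι] (A B P N : ι → ℝ≥0∞) (L : ι → ℝ)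
    (hP : ∀ k, P k ≠ ⊤) (hN : ∀ k, N k ≠ ⊤)
    (h : ∀ k, ENNReal.ofReal (L k) * B k + P k ≤ A k + ENNReal.ofReal (-L k) * B k + N k) :
    (∑ k, (L k : EReal) * ((B k : ℝ≥0∞) : EReal)) +
      ((∑ k, ((P k).toReal - (N k).toReal) : ℝ) : EReal) ≤ ((∑ k, A k : ℝ≥0∞) : EReal) := by
  classical
  by_cases hA : ∑ k, A k = ⊤
  · rw [hA]; exact le_top
  have hAk : ∀ k, A k ≠ ⊤ := fun k => by
    simpa using (ENNReal.sum_ne_top.1 hA) k (Finset.mem_univ k)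
  -- Such a direction contributes -∞, which absorbs every other summand in `EReal`, so the left side
  -- is -∞.
  by_cases hbot : ∃ k, L k < 0 ∧ B k = ⊤
  · obtain ⟨k, hk, hBk⟩ := hbot
    rw [← Finset.add_sum_erase _ _ (Finset.mem_univ k), hBk, EReal.coe_ennreal_top,
      EReal.coe_mul_top_of_neg hk, EReal.bot_add, EReal.bot_add]
    exact bot_le
  push Not at hbot
  have hterm : ∀ k, (L k : EReal) * ((B k : ℝ≥0∞) : EReal) = ((L k * (B k).toReal : ℝ) : EReal) ∧
      L k * (B k).toReal + ((P k).toReal - (N k).toReal) ≤ (A k).toReal := by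
    intro k
    have hk := h k
    by_cases hL : L k = 0
    · rw [hL] at hk ⊢
      simp only [neg_zero, ENNReal.ofReal_zero, zero_mul, zero_add, add_zero] at hk
      refine ⟨by simp, ?_⟩
      have := ENNReal.toReal_mono (by finiteness [hAk k, hN k]) hk
      rw [ENNReal.toReal_add (hAk k) (hN k)] at this
      linarith
    have hB : B k ≠ ⊤ := by
      rcases lt_or_gt_of_ne hL with hlt | hgt
      · exact hbot k hlt
      · intro htop
        rw [htop, ENNReal.mul_top (by simpa using hgt), top_add, top_le_iff,
          ENNReal.ofReal_of_nonpos (by linarith), zero_mul, add_zero] at hk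
        exact ENNReal.add_ne_top.2 ⟨hAk k, hN k⟩ hk
    refine ⟨?_, ?_⟩
    · rw [EReal.coe_mul, ← EReal.coe_ennreal_toReal hB]
    · have h1 : ENNReal.ofReal (L k) * B k ≠ ⊤ := ENNReal.mul_ne_top ENNReal.ofReal_ne_top hB
      have h2 : ENNReal.ofReal (-L k) * B k ≠ ⊤ := ENNReal.mul_ne_top ENNReal.ofReal_ne_top hB
      have h3 := ENNReal.toReal_mono
        (ENNReal.add_ne_top.2 ⟨ENNReal.add_ne_top.2 ⟨hAk k, h2⟩, hN k⟩) hk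
      rw [ENNReal.toReal_add h1 (hP k), ENNReal.toReal_add (ENNReal.add_ne_top.2 ⟨hAk k, h2⟩) (hN k),
        ENNReal.toReal_add (hAk k) h2, ENNReal.toReal_mul, ENNReal.toReal_mul] at h3
      rcases le_total 0 (L k) with h0 | h0
      · rw [ENNReal.toReal_ofReal h0, ENNReal.ofReal_of_nonpos (by linarith),
          ENNReal.toReal_zero] at h3
        linarith
      · rw [ENNReal.toReal_ofReal (by linarith : 0 ≤ -L k), ENNReal.ofReal_of_nonpos h0,
          ENNReal.toReal_zero] at h3
        linarith
  rw [← EReal.coe_ennreal_toReal hA, ENNReal.toReal_sum fun k _ => hAk k]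
  simp_rw [fun k => (hterm k).1]
  have hcoe : ∀ f : ι → ℝ, ∑ k, ((f k : ℝ) : EReal) = ((∑ k, f k : ℝ) : EReal) := fun f =>
    (map_sum (⟨⟨fun r : ℝ => (r : EReal), rfl⟩, EReal.coe_add⟩ : ℝ →+ EReal) f _).symm
  rw [hcoe, ← EReal.coe_add, ← Finset.sum_add_distrib]
  exact EReal.coe_le_coe_iff.2 (Finset.sum_le_sum fun k _ => (hterm k).2)

variable {m : ℕ} {k : Fin (m + 1)} {Ω : Set (EuclideanSpace ℝ (Fin (m + 1)))} {α p l ε : ℝ}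
  {W H u v b : EuclideanSpace ℝ (Fin (m + 1)) → ℝ}

/-- The Hardy inequality in one direction with boundary term, for a field `b` that is the Picone
field in the interior of the domain. -/
lemma IsCompatible.hardy_flux_le (hΩ : IsCompatible α Ω) (hp : 1 < p)
    (hWm : AEMeasurable W (volume.restrict Ω)) (hHm : AEMeasurable H (volume.restrict Ω))
    (hW : ∀ x ∈ Ω, 0 ≤ W x) (hH : ∀ x ∈ Ω, 0 ≤ H x)
    (hv : IsConformableC1On α v Ω) (hvpos : ∀ x ∈ Ω, 0 < v x)
    (hflux : ∀ x ∈ Ω, ConformableDifferentiableAt α k (anisotropicFlux α k p W v) x)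
    (hineq : ∀ x ∈ Ω, l * H x * v x ^ (p - 1) ≤
      -conformableDeriv α k (anisotropicFlux α k p W v) x)
    (hu : IsConformableC1On α u Ω) (hb : ContinuousOn b (frontier Ω))
    (hbl : ∀ y, ContinuousOn (fun t => b (insertCoord k y t)) (insertCoord k y ⁻¹' closure Ω))
    (hbeq : ∀ x ∈ Ω, b x = piconeField p ε u v (anisotropicFlux α k p W v) x) :
    ENNReal.ofReal l * (∫⁻ x in Ω, ENNReal.ofReal (H x * max (u x - ε) 0 ^ p)
          ∂conformableVolume (m + 1) α) +
        ∫⁻ x in frontier Ω, ENNReal.ofReal (b x * conformableNormal α Ω k x) ∂μHE[m] ≤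
      (∫⁻ x in Ω, ENNReal.ofReal (W x * |conformableDeriv α k u x| ^ p)
          ∂conformableVolume (m + 1) α) +
        ENNReal.ofReal (-l) * (∫⁻ x in Ω, ENNReal.ofReal (H x * max (u x - ε) 0 ^ p)
          ∂conformableVolume (m + 1) α) +
        ∫⁻ x in frontier Ω, ENNReal.ofReal (-(b x * conformableNormal α Ω k x)) ∂μHE[m] := by
  have hΩm := hΩ.isOpen.measurableSet
  have hum : AEMeasurable u (volume.restrict Ω) := hu.continuousOn.aemeasurable hΩm
  have hDum : AEMeasurable (conformableDeriv α k u) (volume.restrict Ω) :=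
    (hu.continuousOn_deriv k).aemeasurable hΩm
  have hAm : AEMeasurable (fun x => W x * |conformableDeriv α k u x| ^ p) (volume.restrict Ω) := by
    have : AEMeasurable (fun x => |conformableDeriv α k u x|) (volume.restrict Ω) :=
      measurable_norm.comp_aemeasurable hDum
    exact hWm.mul (this.pow_const p)
  have hBm : AEMeasurable (fun x => H x * max (u x - ε) 0 ^ p) (volume.restrict Ω) :=
    hHm.mul (((hum.sub_const ε).max aemeasurable_const).pow_const p)
  have hA0 : ∀ x ∈ Ω, 0 ≤ W x * |conformableDeriv α k u x| ^ p := fun x hx =>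
    mul_nonneg (hW x hx) (by positivity)
  have hB0 : ∀ x ∈ Ω, 0 ≤ H x * max (u x - ε) 0 ^ p := fun x hx =>
    mul_nonneg (hH x hx) (Real.rpow_nonneg (le_max_right _ _) _)
  -- The constant `l` has no prescribed sign. Writing l = l⁺ - l⁻ and moving l⁻ to the energy side
  -- makes both densities nonnegative.
  have key := hΩ.lintegral_add_flux_le (k := k) hb hbl
    (g := fun x => W x * |conformableDeriv α k u x| ^ p +
      max (-l) 0 * (H x * max (u x - ε) 0 ^ p))
    (h := fun x => max l 0 * (H x * max (u x - ε) 0 ^ p))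
    (hAm.add (hBm.const_mul _)) (hBm.const_mul _)
    (fun x hx => add_nonneg (hA0 x hx) (mul_nonneg (le_max_right _ _) (hB0 x hx)))
    (fun x hx => mul_nonneg (le_max_right _ _) (hB0 x hx))
    (fun y t ht => by
      have ht' : α = 1 ∨ 0 < t := hΩ.pos.imp id fun h => by simpa using h _ ht k
      obtain ⟨D, hD, hDle⟩ := exists_hasDerivAt_piconeField (k := k) (ε := ε) hp ht' (hW _ ht)
        (hvpos _ ht) (hv.differentiableAt k _ ht) (hu.differentiableAt k _ ht) (hflux _ ht)
        (hineq _ ht)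
      refine ⟨D, hD.congr_of_eventuallyEq ?_, hDle.trans (le_of_eq ?_)⟩
      · filter_upwards [(hΩ.isOpen.preimage (continuous_insertCoord_right k y)).mem_nhds ht]
          with s hs using hbeq _ hs
      · have : l = max l 0 - max (-l) 0 := by
          rcases le_total l 0 with h | h
          · rw [max_eq_right h, max_eq_left (by linarith)]; ring
          · rw [max_eq_left h, max_eq_right (by linarith)]; ring
        conv_lhs => rw [this]
        ring)
  have hof : ∀ r : ℝ, ENNReal.ofReal (max r 0) = ENNReal.ofReal r := fun r => by
    rcases le_total r 0 with h | h
    · rw [max_eq_right h, ENNReal.ofReal_of_nonpos h, ENNReal.ofReal_zero]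
    · rw [max_eq_left h]
  have hB : ∀ r : ℝ, ∫⁻ x in Ω, ENNReal.ofReal (max r 0 * (H x * max (u x - ε) 0 ^ p))
      ∂conformableVolume (m + 1) α = ENNReal.ofReal r *
        ∫⁻ x in Ω, ENNReal.ofReal (H x * max (u x - ε) 0 ^ p) ∂conformableVolume (m + 1) α := by
    intro r
    simp_rw [ENNReal.ofReal_mul (le_max_right r 0), hof]
    exact lintegral_const_mul' _ _ ENNReal.ofReal_ne_top
  have hG : ∫⁻ x in Ω, ENNReal.ofReal (W x * |conformableDeriv α k u x| ^ p +
      max (-l) 0 * (H x * max (u x - ε) 0 ^ p)) ∂conformableVolume (m + 1) α =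
      (∫⁻ x in Ω, ENNReal.ofReal (W x * |conformableDeriv α k u x| ^ p)
          ∂conformableVolume (m + 1) α) +
        ENNReal.ofReal (-l) * (∫⁻ x in Ω, ENNReal.ofReal (H x * max (u x - ε) 0 ^ p)
          ∂conformableVolume (m + 1) α) := by
    rw [← hB, ← lintegral_add_left' (aemeasurable_restrict_conformableVolume hAm).ennreal_ofReal]
    refine setLIntegral_congr_fun hΩm fun x hx => ?_
    exact ENNReal.ofReal_add (hA0 x hx) (mul_nonneg (le_max_right _ _) (hB0 x hx))
  rw [hB, hG] at key
  exact key

/-- The Hardy inequality in one direction for functions that vanish on the boundary. -/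
lemma IsCompatible.hardy_le_of_eq_zero (hΩ : IsCompatible α Ω) (hp : 1 < p)
    (hWm : AEMeasurable W (volume.restrict Ω)) (hHm : AEMeasurable H (volume.restrict Ω))
    (hW : ∀ x ∈ Ω, 0 ≤ W x) (hH : ∀ x ∈ Ω, 0 ≤ H x)
    (hv : IsConformableC1On α v Ω) (hvpos : ∀ x ∈ Ω, 0 < v x)
    (hflux : ∀ x ∈ Ω, ConformableDifferentiableAt α k (anisotropicFlux α k p W v) x)
    (hineq : ∀ x ∈ Ω, l * H x * v x ^ (p - 1) ≤
      -conformableDeriv α k (anisotropicFlux α k p W v) x)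
    (hu : IsConformableC1On α u Ω) (huc : ContinuousOn u (closure Ω)) (hu0 : ∀ x ∈ Ω, 0 ≤ u x)
    (hub : ∀ x ∈ frontier Ω, u x = 0) :
    ENNReal.ofReal l * (∫⁻ x in Ω, ENNReal.ofReal (H x * |u x| ^ p)
          ∂conformableVolume (m + 1) α) ≤
      (∫⁻ x in Ω, ENNReal.ofReal (W x * |conformableDeriv α k u x| ^ p)
          ∂conformableVolume (m + 1) α) +
        ENNReal.ofReal (-l) * (∫⁻ x in Ω, ENNReal.ofReal (H x * |u x| ^ p)
          ∂conformableVolume (m + 1) α) := by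
  have hΩm := hΩ.isOpen.measurableSet
  have hp0 : 0 < p := by linarith
  have hle : ∀ ε : ℝ, 0 < ε → ∀ x ∈ Ω, H x * max (u x - ε) 0 ^ p ≤ H x * |u x| ^ p := by
    intro ε hε x hx
    refine mul_le_mul_of_nonneg_left (Real.rpow_le_rpow (le_max_right _ _) ?_ hp0.le) (hH x hx)
    exact max_le ((sub_le_self _ hε.le).trans (le_abs_self _)) (abs_nonneg _)
  have key : ∀ ε : ℝ, 0 < ε → ENNReal.ofReal l *
      (∫⁻ x in Ω, ENNReal.ofReal (H x * max (u x - ε) 0 ^ p) ∂conformableVolume (m + 1) α) ≤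
      (∫⁻ x in Ω, ENNReal.ofReal (W x * |conformableDeriv α k u x| ^ p)
          ∂conformableVolume (m + 1) α) +
        ENNReal.ofReal (-l) * (∫⁻ x in Ω, ENNReal.ofReal (H x * |u x| ^ p)
          ∂conformableVolume (m + 1) α) := by
    intro ε hε
    set G := anisotropicFlux α k p W v with hG
    have hfr : ∀ x ∈ frontier Ω, x ∉ Ω := fun x hx hx' => hx.2 (hΩ.isOpen.interior_eq.symm ▸ hx')
    have hb0 : ∀ x ∈ frontier Ω, Ω.indicator (piconeField p ε u v G) x = 0 := fun x hx =>
      indicator_of_notMem (hfr x hx) _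
    -- The field extended by 0 outside Ω is admissible: inside it is differentiable along lines, and
    -- near a boundary point u < ε makes it vanish. No boundary behaviour of v or of the flux
    -- enters.
    have h1 := hΩ.hardy_flux_le (k := k) (ε := ε) (b := Ω.indicator (piconeField p ε u v G)) hp hWm
      hHm hW hH hv hvpos hflux hineq hu (continuousOn_const.congr hb0) (fun y t ht => by
        have hcont := continuous_insertCoord_right k y
        by_cases htΩ : insertCoord k y t ∈ Ω
        · have ht' : α = 1 ∨ 0 < t := hΩ.pos.imp id fun h => by simpa using h _ htΩ k
          obtain ⟨D, hD, -⟩ := exists_hasDerivAt_piconeField (k := k) (ε := ε) hp ht' (hW _ htΩ)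
            (hvpos _ htΩ) (hv.differentiableAt k _ htΩ) (hu.differentiableAt k _ htΩ)
            (hflux _ htΩ) (hineq _ htΩ)
          refine (hD.continuousAt.congr ?_).continuousWithinAt
          filter_upwards [(hΩ.isOpen.preimage hcont).mem_nhds htΩ] with s hs
          exact (indicator_of_mem (show insertCoord k y s ∈ Ω from hs) _).symm
        · have hfrt : insertCoord k y t ∈ frontier Ω :=
            ⟨ht, fun h => htΩ (hΩ.isOpen.interior_eq ▸ h)⟩
          have h2 : ContinuousWithinAt (fun s => u (insertCoord k y s))
              (insertCoord k y ⁻¹' closure Ω) t :=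
            (huc _ ht).comp hcont.continuousWithinAt (mapsTo_preimage _ _)
          have h3 := h2.eventually (gt_mem_nhds (show u (insertCoord k y t) < ε by
            rw [hub _ hfrt]; exact hε))
          refine (continuousWithinAt_const (b := (0 : ℝ))).congr_of_eventuallyEq_of_mem ?_ ht
          filter_upwards [h3] with s hs
          by_cases hsΩ : insertCoord k y s ∈ Ω
          · rw [indicator_of_mem hsΩ, piconeField, max_eq_right (by linarith),
              Real.zero_rpow hp0.ne']
            simp
          · exact indicator_of_notMem hsΩ _)
      (fun x hx => indicator_of_mem hx _)
    have hz : ∀ σ : ℝ, ∫⁻ x in frontier Ω, ENNReal.ofReal (σ *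
        (Ω.indicator (piconeField p ε u v G) x * conformableNormal α Ω k x)) ∂μHE[m] = 0 := by
      intro σ
      rw [setLIntegral_congr_fun (g := fun _ => 0) isClosed_frontier.measurableSet fun x hx => by
        simp only [hb0 x hx, zero_mul, mul_zero, ENNReal.ofReal_zero]]
      simp
    have hz1 := hz 1
    have hz2 := hz (-1)
    simp only [one_mul, neg_mul] at hz1 hz2
    rw [hz1, hz2, add_zero, add_zero] at h1
    refine h1.trans ?_
    exact add_le_add le_rfl (mul_le_mul' le_rfl
      (setLIntegral_mono' hΩm fun x hx => ENNReal.ofReal_le_ofReal (hle ε hε x hx)))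
  have hum : AEMeasurable u (volume.restrict Ω) := hu.continuousOn.aemeasurable hΩm
  -- Along ε = 1/(N+1) the truncations increase to u. Only the left side needs the limit, since
  -- `key` has already replaced the truncation by u in the term with l⁻.
  have hlim : Tendsto (fun N : ℕ => ∫⁻ x in Ω, ENNReal.ofReal
      (H x * max (u x - 1 / ((N : ℝ) + 1)) 0 ^ p) ∂conformableVolume (m + 1) α) atTop
      (𝓝 (∫⁻ x in Ω, ENNReal.ofReal (H x * |u x| ^ p) ∂conformableVolume (m + 1) α)) := by
    refine lintegral_tendsto_of_tendsto_of_monotone (fun N =>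
      (aemeasurable_restrict_conformableVolume (hHm.mul
        (((hum.sub_const _).max aemeasurable_const).pow_const p))).ennreal_ofReal) ?_ ?_
    · refine (ae_restrict_iff' hΩm).2 (ae_of_all _ fun x hx N M hNM => ENNReal.ofReal_le_ofReal ?_)
      refine mul_le_mul_of_nonneg_left (Real.rpow_le_rpow (le_max_right _ _) ?_ hp0.le) (hH x hx)
      exact max_le_max_right _ (sub_le_sub_left (Nat.one_div_le_one_div hNM) _)
    · refine (ae_restrict_iff' hΩm).2 (ae_of_all _ fun x hx => ?_)
      refine (ENNReal.continuous_ofReal.tendsto _).comp (Tendsto.const_mul _ ?_)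
      have h1 : Tendsto (fun N : ℕ => max (u x - 1 / ((N : ℝ) + 1)) 0) atTop (𝓝 |u x|) := by
        have := (tendsto_one_div_add_atTop_nhds_zero_nat (𝕜 := ℝ)).const_sub (u x)
        rw [sub_zero] at this
        have h2 := this.max (tendsto_const_nhds (x := (0 : ℝ)))
        rw [max_eq_left (hu0 x hx)] at h2
        rwa [abs_of_nonneg (hu0 x hx)]
      exact h1.rpow_const (Or.inr hp0.le)
  refine le_of_tendsto' (ENNReal.Tendsto.const_mul hlim (Or.inr ENNReal.ofReal_ne_top)) fun N => ?_
  exact key _ (by positivity)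

end Hardy

end

/-! ### The theorem -/

theorem theorem3p2 {n : ℕ} (α : ℝ) (hα : 0 < α) (hα1 : α ≤ 1)
    (p : Fin n → ℝ) (hp : ∀ k, 1 < p k) (L : Fin n → ℝ)
    (Ω : Set (EuclideanSpace ℝ (Fin n))) (hΩ : IsCompatible α Ω)
    (W H : Fin n → EuclideanSpace ℝ (Fin n) → ℝ)
    (hWm : ∀ k, AEMeasurable (W k) (volume.restrict Ω))
    (hHm : ∀ k, AEMeasurable (H k) (volume.restrict Ω))
    (hW : ∀ k, ∀ x ∈ Ω, 0 ≤ W k x) (hH : ∀ k, ∀ x ∈ Ω, 0 ≤ H k x)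
    (v : EuclideanSpace ℝ (Fin n) → ℝ)
    (hv : IsConformableC1On α v Ω) (hvc : ContinuousOn v (closure Ω))
    (hvpos : ∀ x ∈ Ω, 0 < v x)
    (hflux : ∀ k, ∀ x ∈ Ω, ConformableDifferentiableAt α k (anisotropicFlux α k (p k) (W k) v) x)
    (hineq : ∀ k, ∀ x ∈ Ω,
      L k * H k x * v x ^ (p k - 1) ≤
        -conformableDeriv α k (anisotropicFlux α k (p k) (W k) v) x)
    (u : EuclideanSpace ℝ (Fin n) → ℝ)
    (hu : IsConformableC1On α u Ω) (huc : ContinuousOn u (closure Ω))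
    (hu0 : ∀ x ∈ Ω, 0 ≤ u x) :
    -- the inequality with boundary term, whenever that term is defined
    ((∀ x ∈ frontier Ω, 0 < v x) →
      (∀ k, ∀ x ∈ closure Ω, ∃ y : ℝ,
        Tendsto (anisotropicFlux α k (p k) (W k) v) (𝓝[Ω] x) (𝓝 y)) →
      (∀ k, IntegrableOn (fun x => u x ^ p k / v x ^ (p k - 1) *
          extendFrom Ω (anisotropicFlux α k (p k) (W k) v) x * conformableNormal α Ω k x)
        (frontier Ω) μHE[n - 1]) ∧
      (∑ k, (L k : EReal) *
          ((∫⁻ x in Ω, ENNReal.ofReal (H k x * |u x| ^ p k) ∂conformableVolume n α : ℝ≥0∞) :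
            EReal)) +
        ((∑ k, ∫ x in frontier Ω, u x ^ p k / v x ^ (p k - 1) *
          extendFrom Ω (anisotropicFlux α k (p k) (W k) v) x * conformableNormal α Ω k x
            ∂μHE[n - 1] : ℝ) : EReal) ≤
        ((∑ k, ∫⁻ x in Ω, ENNReal.ofReal (W k x * |conformableDeriv α k u x| ^ p k)
            ∂conformableVolume n α : ℝ≥0∞) : EReal)) ∧
    -- the inequality for functions vanishing on the boundary
    ((∀ x ∈ frontier Ω, u x = 0) →
      (∑ k, (L k : EReal) *
          ((∫⁻ x in Ω, ENNReal.ofReal (H k x * |u x| ^ p k) ∂conformableVolume n α : ℝ≥0∞) :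
            EReal)) ≤
        ((∑ k, ∫⁻ x in Ω, ENNReal.ofReal (W k x * |conformableDeriv α k u x| ^ p k)
            ∂conformableVolume n α : ℝ≥0∞) : EReal)) := by
  -- For n = 0 all sums are empty; otherwise n - 1 = m is the dimension of the boundary.
  rcases n with _ | m
  · exact ⟨fun _ _ => ⟨fun k => k.elim0, by simp⟩, fun _ => by simp⟩
  have hΩm := hΩ.isOpen.measurableSet
  have hfrm : MeasurableSet (frontier Ω) := isClosed_frontier.measurableSet
  refine ⟨fun hvb hext => ?_, fun hub => ?_⟩
  · have hv' : ∀ x ∈ closure Ω, 0 < v x := fun x hx => by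
      by_cases h : x ∈ Ω
      · exact hvpos x h
      · exact hvb x ⟨hx, fun h' => h (interior_subset h')⟩
    have hu' : ∀ x ∈ closure Ω, 0 ≤ u x := fun x hx => by
      have : (𝓝[Ω] x).NeBot := mem_closure_iff_nhdsWithin_neBot.1 hx
      exact ge_of_tendsto ((huc x hx).mono subset_closure)
        (by filter_upwards [self_mem_nhdsWithin] with y hy using hu0 y hy)
    have hGext : ∀ k, ∀ x ∈ Ω, extendFrom Ω (anisotropicFlux α k (p k) (W k) v) x =
        anisotropicFlux α k (p k) (W k) v x := fun k x hx => by
      obtain ⟨y, hy⟩ := hext k x (subset_closure hx)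
      -- The filter `𝓝[Ω] x` contains the point x itself, so a limit at x ∈ Ω can only be the value
      -- there.
      have h1 : y = anisotropicFlux α k (p k) (W k) v x :=
        tendsto_nhds_unique (hy.mono_left (pure_le_nhdsWithin hx)) (tendsto_pure_nhds _ _)
      exact extendFrom_eq (subset_closure hx) (h1 ▸ hy)
    set b : Fin (m + 1) → EuclideanSpace ℝ (Fin (m + 1)) → ℝ := fun k x =>
      u x ^ p k / v x ^ (p k - 1) * extendFrom Ω (anisotropicFlux α k (p k) (W k) v) x with hb
    have hbc : ∀ k, ContinuousOn (b k) (closure Ω) := fun k =>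
      ((huc.rpow_const fun x _ => Or.inr (by linarith [hp k])).div
        (hvc.rpow_const fun x hx => Or.inl (hv' x hx).ne')
        fun x hx => (Real.rpow_pos_of_pos (hv' x hx) _).ne').mul
        (continuousOn_extendFrom subset_rfl (hext k))
    -- The field is continuous on the compact boundary, hence bounded, and the conformable normal is
    -- integrable.
    have hint : ∀ k, IntegrableOn (fun x => b k x * conformableNormal α Ω k x)
        (frontier Ω) μHE[m] := fun k => by
      have hcomp : IsCompact (frontier Ω) :=
        Metric.isCompact_of_isClosed_isBounded isClosed_frontier
          (hΩ.isBounded.closure.subset frontier_subset_closure)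
      obtain ⟨C, hC⟩ := hcomp.exists_bound_of_continuousOn
        ((hbc k).mono frontier_subset_closure)
      exact Integrable.bdd_mul (hΩ.finite_area k)
        (((hbc k).mono frontier_subset_closure).aestronglyMeasurable hfrm)
        ((ae_restrict_iff' hfrm).2 (ae_of_all _ hC))
    refine ⟨hint, ?_⟩
    have hflow : ∀ k, ∫ x in frontier Ω, b k x * conformableNormal α Ω k x ∂μHE[m] =
        (∫⁻ x in frontier Ω, ENNReal.ofReal (b k x * conformableNormal α Ω k x) ∂μHE[m]).toReal -
        (∫⁻ x in frontier Ω,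
          ENNReal.ofReal (-(b k x * conformableNormal α Ω k x)) ∂μHE[m]).toReal := fun k =>
      integral_eq_lintegral_pos_part_sub_lintegral_neg_part (hint k)
    have hfin : ∀ k, ∫⁻ x in frontier Ω,
        ENNReal.ofReal (b k x * conformableNormal α Ω k x) ∂μHE[m] ≠ ⊤ := fun k =>
      (hint k).lintegral_lt_top.ne
    have hfin' : ∀ k, ∫⁻ x in frontier Ω,
        ENNReal.ofReal (-(b k x * conformableNormal α Ω k x)) ∂μHE[m] ≠ ⊤ := fun k =>
      (hint k).neg.lintegral_lt_top.ne
    have hmax : ∀ x ∈ Ω, max (u x - 0) 0 = u x := fun x hx => by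
      rw [sub_zero, max_eq_left (hu0 x hx)]
    -- No truncation is needed (ε = 0): with v > 0 on the closure and the flux extended, the Picone
    -- field itself is continuous up to the boundary.
    have key := EReal.sum_mul_add_sum_le _ _ _ _ L hfin hfin' fun k => by
      have h1 := hΩ.hardy_flux_le (k := k) (ε := 0) (b := b k) (hp k) (hWm k) (hHm k) (hW k) (hH k)
        hv hvpos (hflux k) (hineq k) hu ((hbc k).mono frontier_subset_closure)
        (fun y => (hbc k).comp (continuous_insertCoord_right k y).continuousOn
          (mapsTo_preimage _ _))
        fun x hx => by rw [piconeField, hmax x hx, hb]; simp only [hGext k x hx]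
      exact h1
    simp_rw [← hflow] at key
    refine le_trans (le_of_eq ?_) key
    congr 1
    refine Finset.sum_congr rfl fun k _ => ?_
    congr 2
    refine setLIntegral_congr_fun hΩm fun x hx => ?_
    simp only [hmax x hx, abs_of_nonneg (hu0 x hx)]
  · have key := EReal.sum_mul_add_sum_le _ _ (fun _ => 0) (fun _ => 0) L (by simp) (by simp)
      fun k => by
        have h1 := hΩ.hardy_le_of_eq_zero (k := k) (hp k) (hWm k) (hHm k) (hW k) (hH k)
          hv hvpos (hflux k) (hineq k) hu huc hu0 hub
        simpa only [add_zero] using h1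
    simpa using key
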